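/- **Setting.** For every sample size $n$ let $X_{ij}\in L^2[0,1]$ ($1\le i\le n$, $1\le j\le p=p_n$) be deterministic functional predictors and $\beta_j\in L^2[0,1]$ coefficient functions (all of these may depend on $n$), and let $$Y_i=\sum_{j=1}^{p}\int_0^1 X_{ij}(t)\beta_j(t)\,dt+\varepsilon_i ,\qquad \varepsilon_1,\dots,\varepsilon_n\ \text{i.i.d. } N(0,\sigma^2),\quad \sigma>0 .$$ Fix an orthonormal basis $(b_l)_{l\ge1}$ of $L^2[0,1]$, truncation levels $q_n=o(n)$, regularization parameters $\lambda_n>0$ and penalty functions $\rho_\lambda:[0,\infty)\to\mathbb R$ ($\lambda>0$). Put $\theta_{ijl}=\langle X_{ij},b_l\rangle$, $d_{jl}=(n^{-1}\sum_i\theta_{ijl}^2)^{1/2}$. Let $\Theta_j=(\theta_{ijl}/d_{jl})_{i\le n,\,l\le q_n}$ (columns standardized to $\ell_2$-norm $\sqrt n$) and $\eta_{0j}=(d_{jl}\langle\beta_j,b_l\rangle)_{l\le q_n}$. Let $\mathfrak M_0=\{j:\beta_j\ne0\}$, $s_n=|\mathfrak M_0|$, let $\Theta_{\mathfrak M_0}$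 be the $n\times s_nq_n$ matrix formed by the blocks $\Theta_j$, $j\in\mathfrak M_0$, and let $a_n=\min_{j\in\mathfrak M_0}\|\Theta_j\eta_{0j}\|/\sqrt n$. A *FAR estimate* is a strict local minimizer $\hat\eta=(\hat\eta_1,\dots,\hat\eta_p)$ of $$\frac1{2n}\Big\|Y-\sum_{j}\Theta_j\eta_j\Big\|^2+\sum_{j}\rho_{\lambda_n}\!\Big(\tfrac1{\sqrt n}\|\Theta_j\eta_j\|\Big).$$ For a new observation $X^*=(X_1^*,\dots,X_p^*)\in L^2[0,1]^p$ (it may depend on $n$) put $\theta_j^*=(\langle X_j^*,b_l\rangle/d_{jl})_{l\le q_n}$, $\hat f_j^*=\theta_j^{*T}\hat\eta_j$, $f_{0j}^*=\theta_j^{*T}\eta_{0j}$, and let $\Theta^*=\operatorname{diag}(\theta_k^*)_{k\in\mathfrak M_0}\in\mathbb R^{s_nq_n\times s_n}$. **Conditions.** Let $\alpha\in(0,\tfrac12)$ and let $c_0,\kappa,C,\tilde C>0$ be constants not depending on $n$; conditions involving $n$ need to hold for all large $n$. 1. $\sum_{l}\theta_{ijl}^2l^4\le C^2$ for all $i,j$,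 and $\int_0^1\beta_j^2\le\tilde C$ for $j\in\mathfrak M_0$. 2. For every $\lambda>0$, $\rho_\lambda$ is concave and nondecreasing on $[0,\infty)$ and differentiable on $(0,\infty)$ with nonincreasing derivative, and $\rho_\lambda'(0+)>0$ (possibly $+\infty$). Moreover $\rho'_{\lambda_n}(0+)\ge\kappa\lambda_n$. 3. $n^\alpha a_n\to\infty$. 4. $\rho'_{\lambda_n}(a_n/2)=o(n^{-\alpha}q_n^{-1}s_n^{-1/2})$; $\rho_{\lambda_n}$ is twice differentiable at every $t\ge a_n/2$, and $\sup_{t\ge a_n/2}|\rho''_{\lambda_n}(t)|=o(1)$. 5. All eigenvalues of $\frac1n\Theta_{\mathfrak M_0}^T\Theta_{\mathfrak M_0}$ lie in $[c_0,c_0^{-1}]$; for $j\notin\mathfrak M_0$ the matrix $\Theta_j^T\Theta_j$ is invertible and, with $\|B\|_{\infty,2}=\sup_{\|x\|_\infty=1}\|Bx\|_2$, $$\big\|\Theta_j(\Theta_j^T\Theta_j)^{-1}\Theta_j^T\Theta_{\mathfrak M_0}(\Theta_{\mathfrak M_0}^T\Theta_{\mathfrak M_0})^{-1}\big\|_{\infty,2}<\frac{\sqrt{c_0}}{2\sqrt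 n}\,\frac{\rho'_{\lambda_n}(0+)}{\rho'_{\lambda_n}(a_n/2)}$$ (no requirement when $\rho'_{\lambda_n}(a_n/2)=0$). 6. $\lambda_nn^\alpha q_n\sqrt{s_n}\to0$, $\log(p_nq_n)=o(n^{1-2\alpha}s_n^{-1}q_n^{-2})$, $s_nq_n^{-2}=o(\lambda_n)$. 7. $\rho'_{\lambda_n}(a_n/2)=o(a_nn^{\alpha-1/2}s_n^{-1/2})$, $\sup_{t\ge a_n/2}|\rho''_{\lambda_n}(t)|=O(n^{-1/2})$, $s_n=o(n^{2\alpha})$, $s_nq_n^{-2}=o(n^{-1/2})$. **Statement.** There is a constant $K>0$, depending only on $\sigma$ and $\kappa$, such that, whenever these conditions hold and $q_n+\log p_n\le K\,n\lambda_n^2$ for all large $n$ (that is, $q_n+\log p_n=O(n\lambda_n^2)$ with a sufficiently small implied constant), there are random vectors $\hat\eta=\hat\eta^{(n)}$ with the following properties for every choice of new observations $X^*$: * with probability tending to one as $n\to\infty$, $\hat\eta$ is a FAR estimate and $\hat f_j^*=0$ for all $j\notin\mathfrak M_0$; * for all vectors $\tilde c_0=\tilde c_0^{(n)}\in\mathbb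 R^{s_n}$ with $\tilde c_0^T(\Theta^*)^T(\Theta_{\mathfrak M_0}^T\Theta_{\mathfrak M_0})^{-1}\Theta^*\tilde c_0=1$ for all large $n$, $$\tilde c_0^T\big[\hat f^*_{\mathfrak M_0}-f^*_{0,\mathfrak M_0}+n(\Theta^*)^T(\Theta_{\mathfrak M_0}^T\Theta_{\mathfrak M_0})^{-1}v_{0,\mathfrak M_0}\big]\ \longrightarrow\ N(0,\sigma^2)\quad\text{in distribution,}$$ where $v_{0,\mathfrak M_0}$ is formed by stacking, for $k\in\mathfrak M_0$, the vectors $v_{0,k}=\rho'_{\lambda_n}\big(\tfrac1{\sqrt n}\|\Theta_k\eta_{0k}\|\big)\tfrac1{\sqrt n}\,\dfrac{\Theta_k^T\Theta_k\eta_{0k}}{\|\Theta_k\eta_{0k}\|}$. -/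

import Mathlib

open Filter Topology MeasureTheory ProbabilityTheory Asymptotics
open scoped Matrix

noncomputable section

namespace FAR

/-- The Hilbert space `L²([0,1])` of trajectories and coefficient functions. -/
abbrev L2 : Type := Lp ℝ 2 (volume.restrict (Set.Icc (0 : ℝ) 1))

/-- The Euclidean norm `‖v‖ = √(vᵀ v)` of a finite real vector. -/
def enorm2 {ι : Type*} [Fintype ι] (v : ι → ℝ) : ℝ := √(v ⬝ᵥ v)

/-- `‖B‖_{∞,2} = sup { ‖B x‖₂ : ‖x‖_∞ = 1 }` (the norm on `κ → ℝ` is the maximum norm). -/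
def normInfTwo {ι κ : Type*} [Fintype ι] [Fintype κ] (B : Matrix ι κ ℝ) : ℝ :=
  ⨆ x : {x : κ → ℝ // ‖x‖ = 1}, enorm2 (B *ᵥ x.1)

/-- `ρ'(0+)`, in the extended reals. For a nonincreasing derivative the limit of `ρ'(t)` as
`t ↓ 0` is the supremum of `ρ'` over `(0, ∞)`. -/
def slopeZero (ρ : ℝ → ℝ) : EReal := ⨆ t : Set.Ioi (0 : ℝ), ((deriv ρ t : ℝ) : EReal)

/-- The penalized least squares criterion
`(1/2n) ‖Y - ∑ⱼ Θⱼ ηⱼ‖² + ∑ⱼ ρ(‖Θⱼ ηⱼ‖ / √n)`. -/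
def criterion {n p q : ℕ} (ρ : ℝ → ℝ) (Θ : Fin p → Matrix (Fin n) (Fin q) ℝ) (Y : Fin n → ℝ)
    (η : Fin p → Fin q → ℝ) : ℝ :=
  1 / (2 * n) * enorm2 (Y - ∑ j, Θ j *ᵥ η j) ^ 2 + ∑ j, ρ (1 / √n * enorm2 (Θ j *ᵥ η j))

/-- The deterministic data of a sequence of linear functional additive regression problems,
indexed by the sample size `n`: an orthonormal basis of `L²([0,1])` (`b l` is the basis function
number `l + 1`), the number `p n` of functional predictors, the truncation level `q n`, the
predictors `X n i j`, the coefficient functions `β n j`, the regularization parameter `lam n`,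
and the penalty functions `ρ lam`. -/
structure Setting where
  b : HilbertBasis ℕ ℝ L2
  p : ℕ → ℕ
  q : ℕ → ℕ
  X : ∀ n, Fin n → Fin (p n) → L2
  β : ∀ n, Fin (p n) → L2
  lam : ℕ → ℝ
  ρ : ℝ → ℝ → ℝ

namespace Setting

variable (M : Setting) (n : ℕ)

/-- The `l`-th coefficient of a function in the orthonormal basis. -/
def coef (l : ℕ) (x : L2) : ℝ := inner ℝ (M.b l) x

/-- `n^{-1/2}` times the Euclidean norm of the vector of coefficients
`(θ_{1jl}, …, θ_{njl})` of the predictors. -/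
def scale (j : Fin (M.p n)) (l : ℕ) : ℝ := √((∑ i, M.coef l (M.X n i j) ^ 2) / n)

/-- The design matrix `Θⱼ`, with columns standardized to Euclidean norm `√n`. -/
def design (j : Fin (M.p n)) : Matrix (Fin n) (Fin (M.q n)) ℝ :=
  Matrix.of fun i l => M.coef l (M.X n i j) / M.scale n j l

/-- The true coefficient vector `η_{0j}` relative to the standardized design, so that
`∑_{l < q} θ_{ijl} η_{0,jl}` is the truncated expansion of `∫ X_{ij} βⱼ`. -/
def trueCoef (j : Fin (M.p n)) : Fin (M.q n) → ℝ :=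
  fun l => M.scale n j l * M.coef l (M.β n j)

/-- The coefficient vector `θⱼ*` of a new observation `xs`, in the same standardization. -/
def newCoef (xs : Fin (M.p n) → L2) (j : Fin (M.p n)) : Fin (M.q n) → ℝ :=
  fun l => M.coef l (xs j) / M.scale n j l

/-- The set of signal predictors `{j : βⱼ ≠ 0}`. -/
def active : Finset (Fin (M.p n)) := by
  classical exact Finset.univ.filter fun j => M.β n j ≠ 0

/-- The number `sₙ` of signal predictors. -/
def s : ℕ := (M.active n).card

/-- The design matrix of the signal predictors, with `n` rows and `sₙ qₙ` columns. -/
def designActive : Matrix (Fin n) (M.active n × Fin (M.q n)) ℝ :=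
  Matrix.of fun i jl => M.design n jl.1 i jl.2

/-- `ΘᵀΘ` for the signal predictors. -/
def gram : Matrix (M.active n × Fin (M.q n)) (M.active n × Fin (M.q n)) ℝ :=
  (M.designActive n)ᵀ * M.designActive n

/-- The weakest signal `aₙ = min_{j signal} ‖Θⱼ η_{0j}‖ / √n`. (It is `0` if there is no signal
predictor.) -/
def a : ℝ := ⨅ j : M.active n, 1 / √n * enorm2 (M.design n j *ᵥ M.trueCoef n j)

/-- `Θ* = diag(θ₁*, …, θ_s*)`, the block diagonal matrix whose blocks are the columns `θ_k*`. -/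
def newDesign (xs : Fin (M.p n) → L2) : Matrix (M.active n × Fin (M.q n)) (M.active n) ℝ :=
  Matrix.of fun jl k => if jl.1 = k then M.newCoef n xs jl.1 jl.2 else 0

/-- The vector `v₀`, with blocks
`v_{0k} = ρ'(‖Θ_k η_{0k}‖/√n) n^{-1/2} Θ_kᵀ Θ_k η_{0k} / ‖Θ_k η_{0k}‖`. -/
def v0 : M.active n × Fin (M.q n) → ℝ := fun kl =>
  deriv (M.ρ (M.lam n)) (1 / √n * enorm2 (M.design n kl.1 *ᵥ M.trueCoef n kl.1)) * (1 / √n) *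
    (((M.design n kl.1)ᵀ *ᵥ (M.design n kl.1 *ᵥ M.trueCoef n kl.1)) kl.2 /
      enorm2 (M.design n kl.1 *ᵥ M.trueCoef n kl.1))

/-- The response `Y_i = ∑ⱼ ∫ X_{ij} βⱼ + e_i`, for a realization `e` of the errors. -/
def response (e : Fin n → ℝ) : Fin n → ℝ := fun i => ∑ j, inner ℝ (M.X n i j) (M.β n j) + e i

/-- `η` is a FAR estimate for the responses `Y`: a strict local minimizer of the criterion. -/
def IsFAREstimate (Y : Fin n → ℝ) (η : Fin (M.p n) → Fin (M.q n) → ℝ) : Prop :=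
  ∀ᶠ η' in 𝓝[≠] η, criterion (M.ρ (M.lam n)) (M.design n) Y η <
    criterion (M.ρ (M.lam n)) (M.design n) Y η'

/-- The value `fⱼ* = θⱼ*ᵀ ηⱼ` at the new observation `xs` of the component with coefficients
`ηⱼ`. -/
def newValue (xs : Fin (M.p n) → L2) (η : Fin (M.p n) → Fin (M.q n) → ℝ) (j : Fin (M.p n)) : ℝ :=
  M.newCoef n xs j ⬝ᵥ η j

/-- Sobolev ellipsoid condition on the predictors, with radius `C`, and boundedness of the true
coefficient functions. -/
structure Smooth (C Ct : ℝ) : Prop where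
  sobolev : ∀ n i j, Summable (fun l : ℕ => M.coef l (M.X n i j) ^ 2 * ((l : ℝ) + 1) ^ 4) ∧
    ∑' l : ℕ, M.coef l (M.X n i j) ^ 2 * ((l : ℝ) + 1) ^ 4 ≤ C ^ 2
  bounded : ∀ n, ∀ j ∈ M.active n, ∫ t in Set.Icc (0 : ℝ) 1, M.β n j t ^ 2 ≤ Ct

/-- Conditions on the penalty, the signal strength and the design. -/
structure Regular (α c₀ κ : ℝ) : Prop where
  concave : ∀ lam > 0, ConcaveOn ℝ (Set.Ici 0) (M.ρ lam)
  monotone : ∀ lam > 0, MonotoneOn (M.ρ lam) (Set.Ici 0)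
  differentiable : ∀ lam > 0, ∀ t > 0, DifferentiableAt ℝ (M.ρ lam) t
  antitone_deriv : ∀ lam > 0, AntitoneOn (deriv (M.ρ lam)) (Set.Ioi 0)
  slope_pos : ∀ lam > 0, 0 < slopeZero (M.ρ lam)
  slope_ge : ∀ᶠ n in atTop, ((κ * M.lam n : ℝ) : EReal) ≤ slopeZero (M.ρ (M.lam n))
  signal : Tendsto (fun n : ℕ => (n : ℝ) ^ α * M.a n) atTop atTop
  deriv_small : (fun n : ℕ => deriv (M.ρ (M.lam n)) (M.a n / 2)) =o[atTop]
    fun n : ℕ => (n : ℝ) ^ (-α) * (M.q n : ℝ)⁻¹ * (M.s n : ℝ) ^ (-(1 / 2 : ℝ))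
  differentiable_deriv : ∀ᶠ n in atTop, ∀ t ≥ M.a n / 2,
    DifferentiableAt ℝ (deriv (M.ρ (M.lam n))) t
  second_deriv_small : ∀ δ > 0, ∀ᶠ n in atTop, ∀ t ≥ M.a n / 2,
    |deriv (deriv (M.ρ (M.lam n))) t| ≤ δ
  eigenvalues : ∀ᶠ n : ℕ in atTop, ∀ μ ∈ spectrum ℝ ((1 / n : ℝ) • M.gram n), c₀ ≤ μ ∧ μ ≤ c₀⁻¹
  noise_invertible : ∀ᶠ n in atTop, ∀ j ∉ M.active n,
    IsUnit ((M.design n j)ᵀ * M.design n j).det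
  /- the bound `‖·‖_{∞,2} < (√c₀ / (2√n)) ρ'(0+) / ρ'(aₙ/2)`, cleared of denominators, because
  `ρ'(aₙ/2)` may vanish (and the bound is then vacuous) -/
  irrepresentable : ∀ᶠ n : ℕ in atTop, ∀ j ∉ M.active n,
    ((2 * √n * normInfTwo (M.design n j * ((M.design n j)ᵀ * M.design n j)⁻¹ *
        (M.design n j)ᵀ * M.designActive n * (M.gram n)⁻¹) *
      deriv (M.ρ (M.lam n)) (M.a n / 2) : ℝ) : EReal) <
    ((√c₀ : ℝ) : EReal) * slopeZero (M.ρ (M.lam n))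

/-- Rate conditions for model selection; `K` is the constant in
`qₙ + log pₙ = O(n λₙ²)`. -/
structure SelectionRates (α K : ℝ) : Prop where
  lam_pos : ∀ n, 0 < M.lam n
  q_small : (fun n => (M.q n : ℝ)) =o[atTop] fun n : ℕ => (n : ℝ)
  lam_lower : ∀ᶠ n : ℕ in atTop, M.q n + Real.log (M.p n) ≤ K * (n * M.lam n ^ 2)
  lam_upper : Tendsto (fun n : ℕ => M.lam n * (n : ℝ) ^ α * M.q n * √(M.s n)) atTop (𝓝 0)
  log_dim : (fun n => Real.log (M.p n * M.q n)) =o[atTop]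
    fun n : ℕ => (n : ℝ) ^ (1 - 2 * α) * (M.s n : ℝ)⁻¹ * ((M.q n : ℝ) ^ 2)⁻¹
  approx : (fun n => M.s n * ((M.q n : ℝ) ^ 2)⁻¹) =o[atTop] M.lam

/-- Additional rate conditions for asymptotic normality. -/
structure NormalityRates (α : ℝ) : Prop where
  deriv_rate : (fun n => deriv (M.ρ (M.lam n)) (M.a n / 2)) =o[atTop]
    fun n : ℕ => M.a n * (n : ℝ) ^ (α - 1 / 2) * (M.s n : ℝ) ^ (-(1 / 2 : ℝ))
  second_deriv_rate : ∃ B : ℝ, ∀ᶠ n : ℕ in atTop, ∀ t ≥ M.a n / 2,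
    |deriv (deriv (M.ρ (M.lam n))) t| ≤ B * (n : ℝ) ^ (-(1 / 2 : ℝ))
  s_small : (fun n => (M.s n : ℝ)) =o[atTop] fun n : ℕ => (n : ℝ) ^ (2 * α)
  approx_rate : (fun n => M.s n * ((M.q n : ℝ) ^ 2)⁻¹) =o[atTop]
    fun n : ℕ => (n : ℝ) ^ (-(1 / 2 : ℝ))

end Setting

end FAR

end

/-! The estimate is built by an oracle construction: minimize the criterion over the signal
coefficients only, inside a ball of radius `r = n^{-α}` around the truth, and extend by zero. After
division by `√n`, the signal design becomes a family of maps `A k` whose sum satisfies `c‖x‖² ≤ ‖∑ A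
k x‖² ≤ c⁻¹‖x‖²`. On the ball every component norm stays above `a/2`, where the curvature of the
penalty is so small that the quadratic term dominates its concavity (`penalizedLoss_midpoint_le`).
Hence the restricted minimizer exists for every response, has quadratic growth and is continuous in
the response, which makes it measurable (`exists_continuous_minimizer`).

Everything else is deterministic on the event `Quiet`, where the errors correlate weakly with the
signal design and with the part of each noise predictor orthogonal to it. There the minimizer is
interior (`mem_ball_of_minimizer`), so the stationarity equation holds. For a noise predictor `u =
Θⱼz/√n`, least squares splits `u` into a part orthogonal to the signals, which sees only errors and
bias, and a part in their span. On the latter the stationarity equation replaces the residual by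
penalty gradients, and the irrepresentability condition bounds the result
(`inner_residual_componentMap_le`). The correlation is thus below the slope of the penalty near
zero, and zero blocks are locally optimal (`eventually_penalizedLoss_lt`, `Tuned.isFAREstimate`).

For normality, the stationarity equation is tested against `g = n G⁻¹ Θ* d`, with `G` the Gram
matrix. The centred quantity equals a linear form in the errors, of variance exactly `σ²`, plus a
bias term and a difference of penalty gradients; both are deterministically `o(1)` on `Quiet`
(`Tuned.abs_expansion_le`, `tendsto_remainder`), and Slutsky's argument concludes.

The complement of `Quiet` is bounded by Markov's inequality for the signals and by a chi-square
Chernoff bound with a union bound for the noise predictors (`measure_not_quiet_le`). The latter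
fixes `K`. -/

noncomputable section

namespace FAR

/-! ### Restricted minimization: quadratic growth and continuity in the response. -/

section Penalized

variable {ι E F : Type*} [Fintype ι] [NormedAddCommGroup E] [InnerProductSpace ℝ E]
  [NormedAddCommGroup F] [InnerProductSpace ℝ F]

/-- Penalized least squares with a penalty on the norm of every component. -/
def penalizedLoss (ρ : ℝ → ℝ) (A : ι → E →L[ℝ] F) (y : F) (x : E) : ℝ :=
  1 / 2 * ‖y - ∑ k, A k x‖ ^ 2 + ∑ k, ρ ‖A k x‖

/-- A monotone penalty whose second derivative is small, relative to the eigenvalue bound `c`, on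
`[t₀, ∞)`. -/
structure MildPenalty (ρ : ℝ → ℝ) (c t₀ : ℝ) : Prop where
  pos : 0 < c
  threshold_pos : 0 < t₀
  monotone : MonotoneOn ρ (Set.Ici 0)
  differentiable : ∀ t > 0, DifferentiableAt ℝ ρ t
  antitone_deriv : AntitoneOn (deriv ρ) (Set.Ioi 0)
  differentiable_deriv : ∀ t ≥ t₀, DifferentiableAt ℝ (deriv ρ) t
  second_deriv : ∀ t ≥ t₀, |deriv (deriv ρ) t| ≤ c ^ 2 / 2

/-- Two-sided eigenvalue bounds for a sum of linear maps and for its components. -/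
structure WellConditioned (A : ι → E →L[ℝ] F) (c : ℝ) : Prop where
  lower : ∀ x, c * ‖x‖ ^ 2 ≤ ‖∑ k, A k x‖ ^ 2
  upper : ∀ x, ‖∑ k, A k x‖ ^ 2 ≤ c⁻¹ * ‖x‖ ^ 2
  block : ∀ x, ∑ k, ‖A k x‖ ^ 2 ≤ c⁻¹ * ‖x‖ ^ 2

variable {ρ : ℝ → ℝ} {A : ι → E →L[ℝ] F} {c t₀ r : ℝ}

lemma MildPenalty.deriv_nonneg (h : MildPenalty ρ c t₀) {t : ℝ} (ht : 0 < t) :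
    0 ≤ deriv ρ t := by
  have : deriv ρ t = derivWithin ρ (Set.Ici 0) t :=
    ((h.differentiable t ht).derivWithin
      ((uniqueDiffOn_Ici 0) t ht.le)).symm
  rw [this]
  exact h.monotone.derivWithin_nonneg

/-- The added quadratic has second derivative `c ^ 2 / 2`, exactly the allowed amount of concavity.
-/
lemma MildPenalty.convexOn (h : MildPenalty ρ c t₀) :
    ConvexOn ℝ (Set.Ici t₀) fun t => ρ t + c ^ 2 / 4 * t ^ 2 := by
  have h1 : ∀ t ∈ Set.Ici t₀, HasDerivAt (fun t => ρ t + c ^ 2 / 4 * t ^ 2)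
      (deriv ρ t + c ^ 2 / 2 * t) t := by
    intro t ht
    have := (h.differentiable t (h.threshold_pos.trans_le ht)).hasDerivAt.add
      (((hasDerivAt_id t).pow 2).const_mul (c ^ 2 / 4))
    refine this.congr_deriv ?_
    simp only [id]
    ring
  have h2 : ∀ t ∈ Set.Ici t₀, HasDerivAt (fun t => deriv ρ t + c ^ 2 / 2 * t)
      (deriv (deriv ρ) t + c ^ 2 / 2) t := by
    intro t ht
    have := (h.differentiable_deriv t ht).hasDerivAt.add
      ((hasDerivAt_id t).const_mul (c ^ 2 / 2))
    exact this.congr_deriv (by simp)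
  have hmono : MonotoneOn (fun t => deriv ρ t + c ^ 2 / 2 * t) (Set.Ici t₀) := by
    refine monotoneOn_of_deriv_nonneg (convex_Ici t₀)
      (fun t ht => (h2 t ht).continuousAt.continuousWithinAt)
      (fun t ht => ((h2 t (interior_subset ht)).differentiableAt).differentiableWithinAt) ?_
    intro t ht
    rw [(h2 t (interior_subset ht)).deriv]
    linarith [neg_le_of_abs_le (h.second_deriv t (interior_subset ht))]
  refine MonotoneOn.convexOn_of_deriv (convex_Ici t₀)
      (fun t ht => (h1 t ht).continuousAt.continuousWithinAt)
      (fun t ht => ((h1 t (interior_subset ht)).differentiableAt).differentiableWithinAt) ?_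
  intro s hs t ht hst
  rw [(h1 s (interior_subset hs)).deriv, (h1 t (interior_subset ht)).deriv]
  exact hmono (interior_subset hs) (interior_subset ht) hst

/-- The vector midpoint may have norm below `t₀`, even zero. Monotonicity first passes to the mean
of the two norms, where weak convexity applies; the parallelogram law converts the quadratic
correction. -/
lemma MildPenalty.midpoint_le (h : MildPenalty ρ c t₀) {u w : F} (hu : t₀ ≤ ‖u‖) (hw : t₀ ≤ ‖w‖) :
    ρ ‖(1 / 2 : ℝ) • (u + w)‖ ≤ (ρ ‖u‖ + ρ ‖w‖) / 2 + c ^ 2 / 16 * ‖u - w‖ ^ 2 := by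
  have hle : ‖(1 / 2 : ℝ) • (u + w)‖ ≤ (1 / 2 : ℝ) * ‖u‖ + 1 / 2 * ‖w‖ := by
    rw [norm_smul, Real.norm_of_nonneg (by norm_num)]
    nlinarith [norm_add_le u w]
  have hconv := h.convexOn.2 hu hw (by norm_num : (0 : ℝ) ≤ 1 / 2) (by norm_num : (0 : ℝ) ≤ 1 / 2)
    (by norm_num)
  simp only [smul_eq_mul] at hconv
  have hmono := h.monotone (norm_nonneg _) ((norm_nonneg _).trans hle) hle
  have hsq : ‖(1 / 2 : ℝ) • (u + w)‖ ^ 2 ≤ ((1 / 2 : ℝ) * ‖u‖ + 1 / 2 * ‖w‖) ^ 2 := by gcongr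
  have hpar := parallelogram_law_with_norm ℝ u w
  have hnorm : ‖(1 / 2 : ℝ) • (u + w)‖ ^ 2 = ‖u + w‖ ^ 2 / 4 := by
    rw [norm_smul, Real.norm_of_nonneg (by norm_num)]; ring
  have hc : 0 ≤ c ^ 2 / 4 := by positivity
  have key : c ^ 2 / 4 * ‖(1 / 2 : ℝ) • (u + w)‖ ^ 2
      ≤ c ^ 2 / 4 * ((1 / 2 : ℝ) * ‖u‖ + 1 / 2 * ‖w‖) ^ 2 := mul_le_mul_of_nonneg_left hsq hc
  rw [hnorm] at key
  have : ‖u + w‖ ^ 2 = 2 * ‖u‖ ^ 2 + 2 * ‖w‖ ^ 2 - ‖u - w‖ ^ 2 := by nlinarith [hpar]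
  rw [this] at key
  nlinarith [key, hconv, hmono]

/-- The squared error gains at least `c / 8 * ‖x - z‖ ^ 2` at the midpoint, while the penalties lose
at most `c ^ 2 / 16 * c⁻¹ = c / 16` times the same square. -/
lemma penalizedLoss_midpoint_le (h : MildPenalty ρ c t₀) (hA : WellConditioned A c) (y : F)
    {x z : E} (hx : ∀ k, t₀ ≤ ‖A k x‖) (hz : ∀ k, t₀ ≤ ‖A k z‖) :
    penalizedLoss ρ A y ((1 / 2 : ℝ) • (x + z)) ≤
      (penalizedLoss ρ A y x + penalizedLoss ρ A y z) / 2 - c / 16 * ‖x - z‖ ^ 2 := by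
  have hpen : ∑ k, ρ ‖A k ((1 / 2 : ℝ) • (x + z))‖ ≤
      ∑ k, ((ρ ‖A k x‖ + ρ ‖A k z‖) / 2 + c ^ 2 / 16 * ‖A k (x - z)‖ ^ 2) := by
    refine Finset.sum_le_sum fun k _ => ?_
    simp only [map_smul, map_add, map_sub]
    exact h.midpoint_le (hx k) (hz k)
  rw [Finset.sum_add_distrib, ← Finset.mul_sum, ← Finset.sum_div, Finset.sum_add_distrib] at hpen
  have hblock := mul_le_mul_of_nonneg_left (hA.block (x - z)) (by positivity : 0 ≤ c ^ 2 / 16)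
  have hlow := hA.lower (x - z)
  have hc : c ^ 2 / 16 * (c⁻¹ * ‖x - z‖ ^ 2) = c / 16 * ‖x - z‖ ^ 2 := by
    have := h.pos.ne'
    field_simp
  rw [hc] at hblock
  have hmid : y - ∑ k, A k ((1 / 2 : ℝ) • (x + z)) =
      (1 / 2 : ℝ) • ((y - ∑ k, A k x) + (y - ∑ k, A k z)) := by
    simp only [map_smul, map_add, ← Finset.smul_sum, Finset.sum_add_distrib]
    module
  have hdiff : ∑ k, A k (x - z) = (y - ∑ k, A k z) - (y - ∑ k, A k x) := by
    simp only [map_sub, Finset.sum_sub_distrib]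
    abel
  have hpar := parallelogram_law_with_norm ℝ (y - ∑ k, A k z) (y - ∑ k, A k x)
  have hnorm : ‖y - ∑ k, A k ((1 / 2 : ℝ) • (x + z))‖ ^ 2 =
      ‖(y - ∑ k, A k z) + (y - ∑ k, A k x)‖ ^ 2 / 4 := by
    rw [hmid, norm_smul, Real.norm_of_nonneg (by norm_num), add_comm]; ring
  rw [← hdiff] at hpar
  unfold penalizedLoss
  rw [hnorm]
  nlinarith

/-- On a small ball around `x₀` all components stay bounded away from zero. -/
lemma WellConditioned.le_norm_apply (hA : WellConditioned A c) (hc : 0 < c) {x₀ : E}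
    (h0 : ∀ k, 2 * t₀ ≤ ‖A k x₀‖) (hr : r ≤ √c * t₀) {x : E}
    (hx : x ∈ Metric.closedBall x₀ r) (k : ι) : t₀ ≤ ‖A k x‖ := by
  have h1 : ‖A k (x - x₀)‖ ^ 2 ≤ c⁻¹ * ‖x - x₀‖ ^ 2 :=
    (Finset.single_le_sum (f := fun k => ‖A k (x - x₀)‖ ^ 2) (fun i _ => by positivity)
      (Finset.mem_univ k)).trans (hA.block _)
  have hd : ‖x - x₀‖ ≤ r := by simpa [dist_eq_norm] using hx
  have ht : ‖x - x₀‖ ≤ √c * t₀ := hd.trans hr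
  have ht0 : 0 ≤ t₀ := by
    by_contra! hneg
    have : √c * t₀ < 0 := mul_neg_of_pos_of_neg (Real.sqrt_pos.2 hc) hneg
    linarith [norm_nonneg (x - x₀)]
  have h2 : c⁻¹ * ‖x - x₀‖ ^ 2 ≤ t₀ ^ 2 := by
    have : ‖x - x₀‖ ^ 2 ≤ (√c * t₀) ^ 2 := by gcongr
    rw [mul_pow, Real.sq_sqrt hc.le] at this
    rw [inv_mul_le_iff₀ hc]
    exact this
  have h3 : ‖A k (x - x₀)‖ ≤ t₀ := abs_le_of_sq_le_sq' (h1.trans h2) ht0 |>.2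
  have h4 : ‖A k x₀‖ ≤ ‖A k x‖ + ‖A k (x - x₀)‖ := by
    have : A k x₀ = A k x - A k (x - x₀) := by simp
    rw [this]
    exact norm_sub_le _ _
  linarith [h0 k]

lemma continuousOn_penalizedLoss (h : MildPenalty ρ c t₀) (y : F) {s : Set E}
    (hs : ∀ x ∈ s, ∀ k, t₀ ≤ ‖A k x‖) : ContinuousOn (penalizedLoss ρ A y) s := by
  unfold penalizedLoss
  refine ContinuousOn.add (by fun_prop) (continuousOn_finsetSum _ fun k _ => ?_)
  intro x hx
  have h1 : ContinuousAt ρ ‖A k x‖ :=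
    (h.differentiable _ (h.threshold_pos.trans_le (hs x hx k))).continuousAt
  have h2 : ContinuousAt (fun x => ‖A k x‖) x := by fun_prop
  exact (ContinuousAt.comp (f := fun x => ‖A k x‖) h1 h2).continuousWithinAt

/-- The minimizer over a small ball exists, is unique with quadratic growth, and depends
continuously on the response. -/
theorem exists_continuous_minimizer [FiniteDimensional ℝ E] (h : MildPenalty ρ c t₀)
    (hA : WellConditioned A c) {x₀ : E}
    (h0 : ∀ k, 2 * t₀ ≤ ‖A k x₀‖) (hr0 : 0 ≤ r) (hr : r ≤ √c * t₀) :
    ∃ φ : F → E, Continuous φ ∧ ∀ y, φ y ∈ Metric.closedBall x₀ r ∧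
      ∀ z ∈ Metric.closedBall x₀ r,
        penalizedLoss ρ A y (φ y) + c / 8 * ‖z - φ y‖ ^ 2 ≤ penalizedLoss ρ A y z := by
  have hball := fun x hx k => hA.le_norm_apply h.pos h0 hr (x := x) hx k
  have hex : ∀ y, ∃ x ∈ Metric.closedBall x₀ r, ∀ z ∈ Metric.closedBall x₀ r,
      penalizedLoss ρ A y x + c / 8 * ‖z - x‖ ^ 2 ≤ penalizedLoss ρ A y z := by
    intro y
    obtain ⟨x, hx, hmin⟩ := (isCompact_closedBall x₀ r).exists_isMinOn
      ⟨x₀, Metric.mem_closedBall_self hr0⟩ (continuousOn_penalizedLoss (A := A) h y hball)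
    refine ⟨x, hx, fun z hz => ?_⟩
    have hmem : (1 / 2 : ℝ) • (x + z) ∈ Metric.closedBall x₀ r := by
      rw [smul_add]
      exact (convex_closedBall x₀ r) hx hz (by norm_num) (by norm_num) (by norm_num)
    -- Since the midpoint is no better than the minimizer, the midpoint gain `c / 16` doubles to a
    -- growth constant `c / 8`.
    have h1 := penalizedLoss_midpoint_le h hA y (hball x hx) (hball z hz)
    have h2 : penalizedLoss ρ A y x ≤ _ := hmin hmem
    rw [norm_sub_rev] at h1
    linarith
  choose φ hφ hmin using hex
  refine ⟨φ, ?_, fun y => ⟨hφ y, hmin y⟩⟩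
  set T : E →L[ℝ] F := ∑ k, A k with hT
  have hTapp : ∀ x, ∑ k, A k x = T x := by simp [hT]
  -- Adding the growth inequalities of the two minimizers cancels the penalties and leaves an inner
  -- product linear in `y - y'`.
  have hlip : ∀ y y', ‖φ y - φ y'‖ ≤ (4 / c * ‖T‖) * ‖y - y'‖ := by
    intro y y'
    have h1 := hmin y (φ y') (hφ y')
    have h2 := hmin y' (φ y) (hφ y)
    rw [norm_sub_rev] at h1
    unfold penalizedLoss at h1 h2
    simp only [hTapp] at h1 h2
    have e : ‖y - T (φ y')‖ ^ 2 - ‖y' - T (φ y')‖ ^ 2 - (‖y - T (φ y)‖ ^ 2 - ‖y' - T (φ y)‖ ^ 2)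
        = 2 * inner ℝ (y - y') (T (φ y - φ y')) := by
      simp only [norm_sub_sq_real, map_sub, inner_sub_left, inner_sub_right]
      ring
    have e2 : inner ℝ (y - y') (T (φ y - φ y')) ≤ ‖y - y'‖ * (‖T‖ * ‖φ y - φ y'‖) :=
      (real_inner_le_norm _ _).trans (by gcongr; exact T.le_opNorm _)
    have key : c / 4 * ‖φ y - φ y'‖ ^ 2 ≤ ‖y - y'‖ * (‖T‖ * ‖φ y - φ y'‖) := by linarith
    rcases (norm_nonneg (φ y - φ y')).eq_or_lt with hz | hpos
    · rw [← hz]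
      have := h.pos
      positivity
    · have : c / 4 * ‖φ y - φ y'‖ ≤ ‖y - y'‖ * ‖T‖ := by
        refine le_of_mul_le_mul_right ?_ hpos
        nlinarith
      have hc := h.pos
      calc ‖φ y - φ y'‖ = 4 / c * (c / 4 * ‖φ y - φ y'‖) := by field_simp
        _ ≤ 4 / c * (‖y - y'‖ * ‖T‖) := by gcongr
        _ = _ := by ring
  have hK : 0 ≤ 4 / c * ‖T‖ := by have := h.pos; positivity
  refine (LipschitzWith.of_dist_le_mul (K := ⟨_, hK⟩) fun y y' => ?_).continuous
  rw [dist_eq_norm, dist_eq_norm]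
  exact hlip y y'

end Penalized

/-! ### Interior minimizers, first order conditions, and adding zero components. -/

section Stationary

variable {ι E F : Type*} [Fintype ι] [NormedAddCommGroup E] [InnerProductSpace ℝ E]
  [NormedAddCommGroup F] [InnerProductSpace ℝ F]
  {ρ : ℝ → ℝ} {A : ι → E →L[ℝ] F} {c t₀ r : ℝ}

/-- The gradient of `u ↦ ρ ‖u‖` away from `0`. -/
def penaltyGradient (ρ : ℝ → ℝ) (u : F) : F := (deriv ρ ‖u‖ / ‖u‖) • u

lemma MildPenalty.abs_sub_le (h : MildPenalty ρ c t₀) {s t : ℝ} (hs : t₀ ≤ s) (ht : t₀ ≤ t) :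
    |ρ t - ρ s| ≤ deriv ρ t₀ * |t - s| := by
  have := (convex_Ici t₀).norm_image_sub_le_of_norm_deriv_le (f := ρ) (C := deriv ρ t₀)
    (fun u hu => h.differentiable u (h.threshold_pos.trans_le hu))
    (fun u hu => by
      have hu0 : 0 < u := h.threshold_pos.trans_le hu
      rw [Real.norm_of_nonneg (h.deriv_nonneg hu0)]
      exact h.antitone_deriv h.threshold_pos hu0 hu) hs ht
  simpa [Real.norm_eq_abs] using this

lemma MildPenalty.norm_penaltyGradient_le (h : MildPenalty ρ c t₀) {u : F} (hu : t₀ ≤ ‖u‖) :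
    ‖penaltyGradient ρ u‖ ≤ deriv ρ t₀ := by
  have hpos := h.threshold_pos.trans_le hu
  rw [penaltyGradient, norm_smul, Real.norm_of_nonneg
    (div_nonneg (h.deriv_nonneg hpos) hpos.le), div_mul_cancel₀ _ hpos.ne']
  exact h.antitone_deriv h.threshold_pos hpos hu

/-- The gradient varies through its length, controlled by `ρ''`, and through its direction,
controlled by the slope divided by the distance from the origin. -/
lemma MildPenalty.norm_penaltyGradient_sub_le (h : MildPenalty ρ c t₀) {M : ℝ}
    (hM : ∀ t ≥ t₀, |deriv (deriv ρ) t| ≤ M) {u u₀ : F} (hu : t₀ ≤ ‖u‖) (hu₀ : 2 * t₀ ≤ ‖u₀‖) :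
    ‖penaltyGradient ρ u - penaltyGradient ρ u₀‖ ≤ (M + deriv ρ t₀ / t₀) * ‖u - u₀‖ := by
  have ht := h.threshold_pos
  have hup : 0 < ‖u‖ := ht.trans_le hu
  have hu0p : 0 < ‖u₀‖ := by linarith
  have hu0t : t₀ ≤ ‖u₀‖ := by linarith
  have hlip : |deriv ρ ‖u‖ - deriv ρ ‖u₀‖| ≤ M * ‖u - u₀‖ := by
    have := (convex_Ici t₀).norm_image_sub_le_of_norm_deriv_le (f := deriv ρ) (C := M)
      (fun v hv => h.differentiable_deriv v hv) (fun v hv => hM v hv) hu0t hu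
    rw [Real.norm_eq_abs, Real.norm_eq_abs] at this
    have hM0 : 0 ≤ M := (abs_nonneg _).trans (hM t₀ le_rfl)
    exact this.trans (mul_le_mul_of_nonneg_left (abs_norm_sub_norm_le u u₀) hM0)
  have hdecomp : penaltyGradient ρ u - penaltyGradient ρ u₀ =
      ((deriv ρ ‖u‖ - deriv ρ ‖u₀‖) * ‖u‖⁻¹) • u +
      (deriv ρ ‖u₀‖ / ‖u₀‖) • (((‖u₀‖ - ‖u‖) * ‖u‖⁻¹) • u + (u - u₀)) := by
    unfold penaltyGradient
    have e1 : (deriv ρ ‖u₀‖ / ‖u₀‖) * ((‖u₀‖ - ‖u‖) * ‖u‖⁻¹) =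
        deriv ρ ‖u₀‖ * ‖u‖⁻¹ - deriv ρ ‖u₀‖ / ‖u₀‖ := by
      field_simp
    rw [smul_add, smul_smul, e1, div_eq_mul_inv (deriv ρ ‖u‖)]
    module
  have hd0 : 0 ≤ deriv ρ ‖u₀‖ := h.deriv_nonneg hu0p
  have hd1 : deriv ρ ‖u₀‖ ≤ deriv ρ t₀ := h.antitone_deriv ht hu0p hu0t
  have hn1 : ‖((deriv ρ ‖u‖ - deriv ρ ‖u₀‖) * ‖u‖⁻¹) • u‖ ≤ M * ‖u - u₀‖ := by
    rw [norm_smul, norm_mul, norm_inv, norm_norm, mul_assoc, inv_mul_cancel₀ hup.ne', mul_one]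
    exact hlip
  have hn2 : ‖((‖u₀‖ - ‖u‖) * ‖u‖⁻¹) • u + (u - u₀)‖ ≤ 2 * ‖u - u₀‖ := by
    refine (norm_add_le _ _).trans ?_
    rw [norm_smul, norm_mul, norm_inv, norm_norm, mul_assoc, inv_mul_cancel₀ hup.ne', mul_one,
      Real.norm_eq_abs]
    have := abs_norm_sub_norm_le u₀ u
    rw [norm_sub_rev] at this
    linarith
  have hd2 : 0 ≤ deriv ρ t₀ := hd0.trans hd1
  have hd3 : 0 ≤ deriv ρ t₀ / (2 * t₀) := by positivity
  -- The assumption `2 * t₀ ≤ ‖u₀‖` compensates the factor `2` in the direction estimate `hn2`.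
  have hq : deriv ρ ‖u₀‖ / ‖u₀‖ ≤ deriv ρ t₀ / (2 * t₀) := by gcongr
  have hq0 : 0 ≤ deriv ρ ‖u₀‖ / ‖u₀‖ := by positivity
  rw [hdecomp]
  refine (norm_add_le _ _).trans ?_
  rw [norm_smul (deriv ρ ‖u₀‖ / ‖u₀‖), Real.norm_of_nonneg hq0]
  calc _ ≤ M * ‖u - u₀‖ + deriv ρ t₀ / (2 * t₀) * (2 * ‖u - u₀‖) := by gcongr
    _ = _ := by field_simp

/-- Cauchy–Schwarz over the components, so that no factor counting the components enters the
remainder. -/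
lemma sum_mul_le_of_block (hA : WellConditioned A c) (hc : 0 < c) (x z : E) :
    ∑ k, ‖A k x‖ * ‖A k z‖ ≤ c⁻¹ * (‖x‖ * ‖z‖) := by
  have h1 := Finset.sum_mul_sq_le_sq_mul_sq Finset.univ (fun k => ‖A k x‖) (fun k => ‖A k z‖)
  have h2 : (∑ k, ‖A k x‖ * ‖A k z‖) ^ 2 ≤ (c⁻¹ * (‖x‖ * ‖z‖)) ^ 2 := by
    refine h1.trans ?_
    calc _ ≤ (c⁻¹ * ‖x‖ ^ 2) * (c⁻¹ * ‖z‖ ^ 2) := by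
          gcongr
          · exact hA.block x
          · exact hA.block z
      _ = _ := by ring
  exact abs_le_of_sq_le_sq' h2 (by positivity) |>.2

lemma abs_sum_inner_penaltyGradient_sub_le (h : MildPenalty ρ c t₀) (hA : WellConditioned A c)
    {M : ℝ} (hM : ∀ t ≥ t₀, |deriv (deriv ρ) t| ≤ M) {x x₀ : E}
    (hx : ∀ k, t₀ ≤ ‖A k x‖) (hx₀ : ∀ k, 2 * t₀ ≤ ‖A k x₀‖) (z : E) :
    |∑ k, inner ℝ (penaltyGradient ρ (A k x) - penaltyGradient ρ (A k x₀)) (A k z)| ≤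
      (M + deriv ρ t₀ / t₀) * (c⁻¹ * (‖x - x₀‖ * ‖z‖)) := by
  have hpos : 0 ≤ M + deriv ρ t₀ / t₀ := by
    have := (abs_nonneg _).trans (hM t₀ le_rfl)
    have := h.deriv_nonneg h.threshold_pos
    have := h.threshold_pos
    positivity
  refine (Finset.abs_sum_le_sum_abs _ _).trans ?_
  calc _ ≤ ∑ k, (M + deriv ρ t₀ / t₀) * (‖A k (x - x₀)‖ * ‖A k z‖) := by
        refine Finset.sum_le_sum fun k _ => (abs_real_inner_le_norm _ _).trans ?_
        rw [map_sub, ← mul_assoc]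
        gcongr
        exact h.norm_penaltyGradient_sub_le hM (hx k) (hx₀ k)
    _ ≤ _ := by
        rw [← Finset.mul_sum]
        gcongr
        exact sum_mul_le_of_block hA h.pos _ _

/-- If the noise is small, a minimizer over the closed ball around the truth lies in its
interior. -/
theorem mem_ball_of_minimizer (h : MildPenalty ρ c t₀) (hA : WellConditioned A c) {x₀ x : E}
    {e : F} {τ : ℝ} (h0 : ∀ k, 2 * t₀ ≤ ‖A k x₀‖) (hr0 : 0 < r) (hr : r ≤ √c * t₀)
    (hx : x ∈ Metric.closedBall x₀ r)
    (hmin : penalizedLoss ρ A (∑ k, A k x₀ + e) x ≤ penalizedLoss ρ A (∑ k, A k x₀ + e) x₀)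
    (hnoise : ∀ z, inner ℝ e (∑ k, A k z) ≤ τ * ‖z‖)
    (hsmall : τ + deriv ρ t₀ * (√(Fintype.card ι) / √c) < c / 2 * r) :
    x ∈ Metric.ball x₀ r := by
  by_contra hnot
  have hle : ‖x - x₀‖ ≤ r := by simpa [dist_eq_norm] using hx
  have hge : r ≤ ‖x - x₀‖ := by simpa [dist_eq_norm] using hnot
  have heq : ‖x - x₀‖ = r := le_antisymm hle hge
  have hpen : ∑ k, ρ ‖A k x₀‖ - ∑ k, ρ ‖A k x‖ ≤ deriv ρ t₀ * ∑ k, ‖A k (x - x₀)‖ := by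
    rw [← Finset.sum_sub_distrib, Finset.mul_sum]
    refine Finset.sum_le_sum fun k _ => ?_
    have h1 := h.abs_sub_le (hA.le_norm_apply h.pos h0 hr hx k)
      (by linarith [h0 k, h.threshold_pos] : t₀ ≤ ‖A k x₀‖)
    have h2 : |‖A k x₀‖ - ‖A k x‖| ≤ ‖A k (x - x₀)‖ := by
      rw [map_sub, ← norm_sub_rev]
      exact abs_norm_sub_norm_le _ _
    exact (le_abs_self _).trans (h1.trans
      (mul_le_mul_of_nonneg_left h2 (h.deriv_nonneg h.threshold_pos)))
  -- The penalty acts on unsquared norms, so Cauchy–Schwarz costs the square root of the number of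
  -- components.
  have hsum : ∑ k, ‖A k (x - x₀)‖ ≤ √(Fintype.card ι) / √c * r := by
    have h1 := Finset.sum_mul_sq_le_sq_mul_sq Finset.univ (fun _ : ι => (1 : ℝ))
      (fun k => ‖A k (x - x₀)‖)
    have h2 : (∑ k, ‖A k (x - x₀)‖) ^ 2 ≤ (√(Fintype.card ι) / √c * r) ^ 2 := by
      rw [mul_pow, div_pow, Real.sq_sqrt (by positivity), Real.sq_sqrt h.pos.le]
      simp only [one_mul, one_pow, Finset.sum_const, Finset.card_univ, nsmul_eq_mul, mul_one] at h1
      refine h1.trans ?_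
      have h3 := hA.block (x - x₀)
      rw [heq] at h3
      calc _ ≤ (Fintype.card ι : ℝ) * (c⁻¹ * r ^ 2) := by gcongr
        _ = _ := by rw [div_eq_mul_inv]; ring
    exact abs_le_of_sq_le_sq' h2 (by positivity) |>.2
  have hlow := hA.lower (x - x₀)
  have hn := hnoise (x - x₀)
  rw [heq] at hlow hn
  unfold penalizedLoss at hmin
  have e1 : ∑ k, A k x₀ + e - ∑ k, A k x = e - ∑ k, A k (x - x₀) := by
    simp only [map_sub, Finset.sum_sub_distrib]; abel
  have e2 : ∑ k, A k x₀ + e - ∑ k, A k x₀ = e := by abel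
  -- On the sphere, leaving the truth costs at least `c / 2 * r ^ 2` and gains at most `r` times the
  -- left side of `hsmall`.
  rw [e1, e2, norm_sub_sq_real] at hmin
  have h4 : deriv ρ t₀ * ∑ k, ‖A k (x - x₀)‖ ≤ deriv ρ t₀ * (√(Fintype.card ι) / √c * r) :=
    mul_le_mul_of_nonneg_left hsum (h.deriv_nonneg h.threshold_pos)
  have h5 := mul_lt_mul_of_pos_right hsmall hr0
  nlinarith

lemma hasDerivAt_norm_line {u w : F} (hu : u ≠ 0) :
    HasDerivAt (fun s : ℝ => ‖u + s • w‖) (inner ℝ u w / ‖u‖) 0 := by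
  have h1 : HasDerivAt (fun s : ℝ => u + s • w) w 0 := by
    simpa using ((hasDerivAt_id (0 : ℝ)).smul_const w).const_add u
  have h2 := h1.norm_sq.sqrt (by simpa using hu)
  simp only [Real.sqrt_sq (norm_nonneg _), zero_smul, add_zero] at h2
  refine h2.congr_deriv ?_
  have : ‖u‖ ≠ 0 := norm_ne_zero_iff.2 hu
  field_simp

/-- First order conditions at an interior minimizer. -/
theorem inner_residual_eq_of_minimizer (h : MildPenalty ρ c t₀) {y : F} {x₀ x : E}
    (hpos : ∀ k, t₀ ≤ ‖A k x‖) (hx : x ∈ Metric.ball x₀ r)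
    (hmin : ∀ z ∈ Metric.closedBall x₀ r, penalizedLoss ρ A y x ≤ penalizedLoss ρ A y z) (z : E) :
    inner ℝ (y - ∑ k, A k x) (∑ k, A k z) = ∑ k, inner ℝ (penaltyGradient ρ (A k x)) (A k z) := by
  have hline : ContinuousAt (fun s : ℝ => x + s • z) 0 := by fun_prop
  have hloc : IsLocalMin (fun s : ℝ => penalizedLoss ρ A y (x + s • z)) 0 := by
    have : ∀ᶠ s in 𝓝 (0 : ℝ), x + s • z ∈ Metric.ball x₀ r :=
      hline (by simpa using Metric.isOpen_ball.mem_nhds hx)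
    filter_upwards [this] with s hs
    simpa using hmin _ (Metric.ball_subset_closedBall hs)
  have hd1 : HasDerivAt (fun s : ℝ => 1 / 2 * ‖y - ∑ k, A k (x + s • z)‖ ^ 2)
      (-inner ℝ (y - ∑ k, A k x) (∑ k, A k z)) 0 := by
    have h1 : HasDerivAt (fun s : ℝ => y - ∑ k, A k (x + s • z)) (-∑ k, A k z) 0 := by
      have h2 : (fun s : ℝ => y - ∑ k, A k (x + s • z)) =
          fun s : ℝ => (y - ∑ k, A k x) + s • (-∑ k, A k z) := by
        funext s
        simp only [map_add, map_smul, Finset.sum_add_distrib, ← Finset.smul_sum]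
        module
      rw [h2]
      simpa using ((hasDerivAt_id (0 : ℝ)).smul_const (-∑ k, A k z)).const_add (y - ∑ k, A k x)
    refine (h1.norm_sq.const_mul (1 / 2)).congr_deriv ?_
    simp only [zero_smul, add_zero, inner_neg_right]
    ring
  have hd2 : ∀ k ∈ Finset.univ, HasDerivAt (fun s : ℝ => ρ ‖A k (x + s • z)‖)
      (inner ℝ (penaltyGradient ρ (A k x)) (A k z)) 0 := by
    intro k _
    have hp := h.threshold_pos.trans_le (hpos k)
    have h1 := hasDerivAt_norm_line (w := A k z) (norm_pos_iff.1 hp)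
    have h2 : HasDerivAt ρ (deriv ρ ‖A k x‖) ‖A k x + (0 : ℝ) • A k z‖ := by
      simpa using (h.differentiable _ hp).hasDerivAt
    have h3 := h2.comp (0 : ℝ) h1
    simp only [map_add, map_smul]
    refine h3.congr_deriv ?_
    rw [penaltyGradient, real_inner_smul_left]
    ring
  have := hloc.hasDerivAt_eq_zero (hd1.add (HasDerivAt.fun_sum hd2))
  linarith

/-- A minimizer over a ball of the active coefficients remains a strict local minimizer when
further components, whose correlation with the residual is small, are added. -/
theorem eventually_penalizedLoss_lt {κ G : Type*} [Fintype κ] [NormedAddCommGroup G]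
    [NormedSpace ℝ G] {B : κ → G →L[ℝ] F} (hB : ∀ j, Function.Injective (B j)) {y : F}
    {x₀ x : E} {L L' t₁ m : ℝ} (hm : 0 < m) (hx : x ∈ Metric.ball x₀ r)
    (hmin : ∀ z ∈ Metric.closedBall x₀ r,
      penalizedLoss ρ A y x + m * ‖z - x‖ ^ 2 ≤ penalizedLoss ρ A y z)
    (ht₁ : 0 < t₁) (hL : ∀ t, 0 ≤ t → t ≤ t₁ → ρ 0 + L * t ≤ ρ t) (hLL : L' < L)
    (hres : ∀ j w, inner ℝ (y - ∑ k, A k x) (B j w) ≤ L' * ‖B j w‖) :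
    ∀ᶠ z : E × (κ → G) in 𝓝 (x, 0), z ≠ (x, 0) →
      penalizedLoss ρ A y x + ∑ _j : κ, ρ 0 <
        1 / 2 * ‖y - ∑ k, A k z.1 - ∑ j, B j (z.2 j)‖ ^ 2 + ∑ k, ρ ‖A k z.1‖ +
          ∑ j, ρ ‖B j (z.2 j)‖ := by
  have e1 : ∀ᶠ z : E × (κ → G) in 𝓝 (x, 0), z.1 ∈ Metric.ball x₀ r :=
    continuous_fst.continuousAt (Metric.isOpen_ball.mem_nhds hx)
  -- Moving the active part perturbs the residual; half of the slack `L - L'` is reserved for this.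
  have e2 : ∀ᶠ z : E × (κ → G) in 𝓝 (x, 0), ‖∑ k, A k (x - z.1)‖ < (L - L') / 2 := by
    have : ContinuousAt (fun z : E × (κ → G) => ‖∑ k, A k (x - z.1)‖) (x, 0) := by fun_prop
    exact this.eventually (gt_mem_nhds (by simpa using hLL))
  have e3 : ∀ᶠ z : E × (κ → G) in 𝓝 (x, 0), ∀ j, ‖B j (z.2 j)‖ < t₁ := by
    refine eventually_all.2 fun j => ?_
    have : ContinuousAt (fun z : E × (κ → G) => ‖B j (z.2 j)‖) (x, 0) := by fun_prop
    exact this.eventually (gt_mem_nhds (by simpa using ht₁))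
  filter_upwards [e1, e2, e3] with z hz1 hz2 hz3 hne
  have hgrow := hmin z.1 (Metric.ball_subset_closedBall hz1)
  have hpen : ∑ j, (ρ 0 + L * ‖B j (z.2 j)‖) ≤ ∑ j, ρ ‖B j (z.2 j)‖ :=
    Finset.sum_le_sum fun j _ => hL _ (norm_nonneg _) (hz3 j).le
  rw [Finset.sum_add_distrib, ← Finset.mul_sum] at hpen
  have hin : inner ℝ (y - ∑ k, A k z.1) (∑ j, B j (z.2 j)) ≤
      (L' + (L - L') / 2) * ∑ j, ‖B j (z.2 j)‖ := by
    rw [inner_sum, Finset.mul_sum]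
    refine Finset.sum_le_sum fun j _ => ?_
    have : y - ∑ k, A k z.1 = (y - ∑ k, A k x) + ∑ k, A k (x - z.1) := by
      simp only [map_sub, Finset.sum_sub_distrib]; abel
    rw [this, inner_add_left, add_mul]
    refine add_le_add (hres j _) ((real_inner_le_norm _ _).trans ?_)
    gcongr
  have hsq := norm_sub_sq_real (y - ∑ k, A k z.1) (∑ j, B j (z.2 j))
  have hnn : 0 ≤ ‖∑ j, B j (z.2 j)‖ ^ 2 := by positivity
  have hS : 0 ≤ ∑ j, ‖B j (z.2 j)‖ := Finset.sum_nonneg fun j _ => norm_nonneg _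
  have hmain : penalizedLoss ρ A y z.1 + ∑ _j : κ, ρ 0 + (L - L') / 2 * ∑ j, ‖B j (z.2 j)‖ ≤
      1 / 2 * ‖y - ∑ k, A k z.1 - ∑ j, B j (z.2 j)‖ ^ 2 + ∑ k, ρ ‖A k z.1‖ +
          ∑ j, ρ ‖B j (z.2 j)‖ := by
    rw [hsq]
    unfold penalizedLoss
    linarith
  -- Strictness comes from injectivity of the `B j` if only the added components move, and from
  -- quadratic growth otherwise.
  by_cases hx1 : z.1 = x
  · have hz2 : z.2 ≠ 0 := fun h0 => hne (Prod.ext hx1 h0)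
    obtain ⟨j, hj⟩ := Function.ne_iff.1 hz2
    have hBj : 0 < ‖B j (z.2 j)‖ := norm_pos_iff.2 fun h0 => hj (hB j (by simpa using h0))
    have hSp : 0 < ∑ j, ‖B j (z.2 j)‖ := hBj.trans_le
      (Finset.single_le_sum (f := fun j => ‖B j (z.2 j)‖) (fun j _ => norm_nonneg _)
        (Finset.mem_univ j))
    have : 0 < (L - L') / 2 * ∑ j, ‖B j (z.2 j)‖ := mul_pos (by linarith) hSp
    have : 0 ≤ m * ‖z.1 - x‖ ^ 2 := by positivity
    linarith
  · have : 0 < ‖z.1 - x‖ := norm_pos_iff.2 (sub_ne_zero.2 hx1)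
    have : 0 < m * ‖z.1 - x‖ ^ 2 := by positivity
    have : 0 ≤ (L - L') / 2 * ∑ j, ‖B j (z.2 j)‖ := mul_nonneg (by linarith) hS
    linarith

/-- The chord from `0` to `t` is at least as steep as the tangent at `t`, hence as the one at `t₁`.
This supplies a linear lower bound with finite slope even if `ρ'(0+)` is infinite. -/
lemma add_deriv_mul_le_of_concaveOn {ρ : ℝ → ℝ} (hρ : ConcaveOn ℝ (Set.Ici 0) ρ)
    (hd : ∀ t > 0, DifferentiableAt ℝ ρ t) (ha : AntitoneOn (deriv ρ) (Set.Ioi 0)) {t t₁ : ℝ}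
    (ht : 0 ≤ t) (htt : t ≤ t₁) : ρ 0 + deriv ρ t₁ * t ≤ ρ t := by
  rcases ht.eq_or_lt with rfl | hpos
  · simp
  · have h1 := hρ.deriv_le_slope (Set.mem_Ici.2 le_rfl) (Set.mem_Ici.2 ht) hpos (hd t hpos)
    have h2 := ha hpos (hpos.trans_le htt) htt
    rw [slope_def_field, sub_zero, le_div_iff₀ hpos] at h1
    nlinarith

end Stationary

/-! ### Gaussian errors: linear forms and chi-square tails. -/

section Gaussian

open scoped NNReal

/-- The integral is `(1 - 2 * θ * v) ^ (-1 / 2)` at exponent `θ`; the choice `θ = 3 / (8 * v)` makes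
it exactly `2`. -/
lemma integral_exp_sq_gaussianReal {v : ℝ≥0} (hv : v ≠ 0) :
    ∫ x, Real.exp (3 / (8 * v) * x ^ 2) ∂gaussianReal 0 v = 2 := by
  have hv' : (0 : ℝ) < v := by positivity
  rw [integral_gaussianReal_eq_integral_smul hv]
  have e : ∀ x : ℝ, gaussianPDFReal 0 v x • Real.exp (3 / (8 * v) * x ^ 2) =
      (√(2 * Real.pi * v))⁻¹ * Real.exp (-(1 / (8 * v)) * x ^ 2) := by
    intro x
    rw [gaussianPDFReal_def, smul_eq_mul, mul_assoc, ← Real.exp_add]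
    congr 2
    field_simp
    ring
  simp_rw [e]
  rw [integral_const_mul, integral_gaussian]
  have : Real.pi / (1 / (8 * (v : ℝ))) = 2 ^ 2 * (2 * Real.pi * v) := by
    field_simp; ring
  rw [this, Real.sqrt_mul (x := 2 ^ 2) (by norm_num), Real.sqrt_sq (by norm_num)]
  have : √(2 * Real.pi * v) ≠ 0 := by positivity
  field_simp

variable {Ω : Type*} [MeasurableSpace Ω] {P : Measure Ω} {n : ℕ} {ε : Fin n → Ω → ℝ} {v : ℝ≥0}

/-- The errors are independent and centred normal. -/
structure IsNoise (ε : Fin n → Ω → ℝ) (v : ℝ≥0) (P : Measure Ω) : Prop where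
  indep : iIndepFun ε P
  law : ∀ i, HasLaw (ε i) (gaussianReal 0 v) P

namespace IsNoise

variable (h : IsNoise ε v P)
include h

lemma hasGaussianLaw : HasGaussianLaw (fun ω => (ε · ω)) P :=
  h.indep.hasGaussianLaw fun i => (h.law i).hasGaussianLaw

lemma memLp (i : Fin n) : MemLp (ε i) 2 P := (h.law i).hasGaussianLaw.memLp_two

lemma integral_eq (i : Fin n) : ∫ ω, ε i ω ∂P = 0 := by
  rw [(h.law i).integral_eq]
  exact integral_id_gaussianReal

lemma covariance_eq (i j : Fin n) : cov[ε i, ε j; P] = if i = j then (v : ℝ) else 0 := by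
  split_ifs with hij
  · subst hij
    rw [covariance_self (h.law i).aemeasurable, (h.law i).variance_eq, variance_id_gaussianReal]
  · exact (h.indep.indepFun hij).covariance_eq_zero (h.memLp i) (h.memLp j)

lemma covariance_sum_sum (a b : Fin n → ℝ) :
    cov[fun ω => ∑ i, a i * ε i ω, fun ω => ∑ i, b i * ε i ω; P] = v * ∑ i, a i * b i := by
  have := h.indep.isProbabilityMeasure
  rw [covariance_fun_sum_fun_sum (X := fun i ω => a i * ε i ω) (Y := fun i ω => b i * ε i ω)
    (fun i => (h.memLp i).const_mul _) (fun i => (h.memLp i).const_mul _)]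
  simp only [covariance_const_mul_left, covariance_const_mul_right, h.covariance_eq, mul_ite,
    mul_zero, Finset.sum_ite_eq, Finset.mem_univ, if_true, Finset.mul_sum]
  exact Finset.sum_congr rfl fun i _ => by ring

lemma hasLaw_sum (a : Fin n → ℝ) :
    HasLaw (fun ω => ∑ i, a i * ε i ω) (gaussianReal 0 (v * (∑ i, a i ^ 2).toNNReal)) P := by
  have := h.indep.isProbabilityMeasure
  have hg : HasGaussianLaw (fun ω => ∑ i, a i * ε i ω) P := by
    have := h.hasGaussianLaw.map_fun (∑ i, a i • ContinuousLinearMap.proj (R := ℝ)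
      (φ := fun _ : Fin n => ℝ) i)
    simpa using this
  refine ⟨hg.aemeasurable, ?_⟩
  rw [hg.map_eq_gaussianReal, ← covariance_self hg.aemeasurable, h.covariance_sum_sum,
    integral_finsetSum _ fun i _ => ((h.memLp i).const_mul _).integrable (by norm_num)]
  simp_rw [integral_const_mul, h.integral_eq, mul_zero, Finset.sum_const_zero, ← pow_two]
  rw [Real.toNNReal_mul v.coe_nonneg, Real.toNNReal_coe]

lemma integral_sum_sq (a : Fin n → ℝ) :
    ∫ ω, (∑ i, a i * ε i ω) ^ 2 ∂P = v * ∑ i, a i ^ 2 := by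
  have hl := h.hasLaw_sum a
  have h1 : Var[fun ω => ∑ i, a i * ε i ω; P] = v * ∑ i, a i ^ 2 := by
    rw [hl.variance_eq, variance_id_gaussianReal]
    simp [Finset.sum_nonneg fun i (_ : i ∈ Finset.univ) => sq_nonneg (a i)]
  rw [← h1, variance_eq_integral hl.aemeasurable]
  have : ∫ ω, ∑ i, a i * ε i ω ∂P = 0 := by
    rw [hl.integral_eq]
    exact integral_id_gaussianReal
  simp [this]

lemma integrable_sum_sq (a : Fin n → ℝ) : Integrable (fun ω => (∑ i, a i * ε i ω) ^ 2) P :=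
  (memLp_finsetSum _ fun i _ => (h.memLp i).const_mul (a i)).integrable_sq

/-- Tail bound for the squared length of the projection of the noise on `d` orthonormal
directions. -/
lemma measure_le_sum_sq (hv : v ≠ 0) {d : ℕ} {u : Fin d → EuclideanSpace ℝ (Fin n)}
    (hu : Orthonormal ℝ u) (x : ℝ) :
    P {ω | x ≤ ∑ l, (∑ i, u l i * ε i ω) ^ 2} ≤
      ENNReal.ofReal (Real.exp (-(3 / (8 * v)) * x) * 2 ^ d) := by
  have := h.indep.isProbabilityMeasure
  have hort : ∀ k l, ∑ i, u k i * u l i = if k = l then 1 else 0 := by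
    intro k l
    rw [← orthonormal_iff_ite.1 hu k l]
    simp [PiLp.inner_apply, mul_comm]
  have hlaw : ∀ l, HasLaw (fun ω => ∑ i, u l i * ε i ω) (gaussianReal 0 v) P := by
    intro l
    have := h.hasLaw_sum (u l)
    have e : ∑ i, u l i ^ 2 = 1 := by
      simpa [pow_two] using hort l l
    simpa [e] using this
  have hind : iIndepFun (fun l ω => ∑ i, u l i * ε i ω) P := by
    -- Orthogonal directions give uncorrelated coordinates of a jointly Gaussian vector, hence
    -- independent ones.
    refine HasGaussianLaw.iIndepFun_of_covariance_eq_zero ?_ fun k l hkl => ?_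
    · have := h.hasGaussianLaw.map_fun (ContinuousLinearMap.pi fun l =>
        ∑ i, u l i • ContinuousLinearMap.proj (R := ℝ) (φ := fun _ : Fin n => ℝ) i)
      refine this.congr (ae_of_all _ fun ω => ?_)
      funext l
      simp
    · rw [h.covariance_sum_sum, hort, if_neg hkl, mul_zero]
  have hind2 : iIndepFun (fun l ω => (∑ i, u l i * ε i ω) ^ 2) P :=
    hind.comp (fun _ x => x ^ 2) fun _ => by fun_prop
  have hmgf1 : ∀ l, mgf (fun ω => (∑ i, u l i * ε i ω) ^ 2) P (3 / (8 * v)) = 2 := by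
    intro l
    rw [← integral_exp_sq_gaussianReal hv, mgf]
    exact (hlaw l).integral_comp (f := fun x => Real.exp (3 / (8 * v) * x ^ 2))
      (by fun_prop)
  have hmgf : mgf (∑ l, fun ω => (∑ i, u l i * ε i ω) ^ 2) P (3 / (8 * v)) = 2 ^ d := by
    rw [hind2.mgf_sum₀ fun l => (hlaw l).aemeasurable.pow_const 2]
    simp [hmgf1]
  -- A non-integrable function would have integral `0` by convention, contradicting the value `2 ^
  -- d`.
  have hint : Integrable (fun ω => Real.exp
      (3 / (8 * v) * (∑ l, fun ω => (∑ i, u l i * ε i ω) ^ 2) ω)) P := by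
    by_contra hn
    rw [mgf, integral_undef hn] at hmgf
    have : (2 : ℝ) ^ d ≠ 0 := by positivity
    exact this hmgf.symm
  have hch := measure_ge_le_exp_mul_mgf (X := ∑ l, fun ω => (∑ i, u l i * ε i ω) ^ 2) x
    (by positivity : (0 : ℝ) ≤ 3 / (8 * v)) hint
  rw [hmgf] at hch
  simp only [Finset.sum_apply] at hch
  rw [← ofReal_measureReal]
  exact ENNReal.ofReal_le_ofReal hch

/-- With high probability the noise has small correlation with all vectors of a subspace of small
dimension. -/
lemma measure_exists_mem_lt_inner (hv : v ≠ 0) (V : Submodule ℝ (EuclideanSpace ℝ (Fin n))) {x : ℝ}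
    (hx : 0 ≤ x) {d : ℕ} (hd : Module.finrank ℝ V ≤ d) :
    P {ω | ∃ w ∈ V, x * ‖w‖ < inner ℝ (WithLp.toLp 2 fun i => ε i ω) w} ≤
      ENNReal.ofReal (Real.exp (-(3 / (8 * v)) * x ^ 2) * 2 ^ d) := by
  set b := stdOrthonormalBasis ℝ V
  have hu : Orthonormal ℝ fun l => (b l : EuclideanSpace ℝ (Fin n)) :=
    b.orthonormal.comp_linearIsometry V.subtypeₗᵢ
  refine (measure_mono ?_).trans ((h.measure_le_sum_sq hv hu (x ^ 2)).trans
    (ENNReal.ofReal_le_ofReal ?_))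
  · rintro ω ⟨w, hw, hlt⟩
    by_contra! hcon
    simp only [Set.mem_ofPred_eq, not_le] at hcon
    set e : EuclideanSpace ℝ (Fin n) := WithLp.toLp 2 fun i => ε i ω
    have hin : ∀ l, ∑ i, (b l : EuclideanSpace ℝ (Fin n)) i * ε i ω =
        inner ℝ e (b l : EuclideanSpace ℝ (Fin n)) := by
      intro l
      simp [e, PiLp.inner_apply]
    have hrep : w = ∑ l, inner ℝ (b l) (⟨w, hw⟩ : V) • (b l : EuclideanSpace ℝ (Fin n)) := by
      have := congrArg (Subtype.val) (b.sum_repr' (⟨w, hw⟩ : V))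
      simpa using this.symm
    have h1 : inner ℝ e w = ∑ l, inner ℝ (b l) (⟨w, hw⟩ : V) *
        inner ℝ e (b l : EuclideanSpace ℝ (Fin n)) := by
      conv_lhs => rw [hrep]
      simp [inner_sum, real_inner_smul_right]
    have h2 : ∑ l, inner ℝ (b l) (⟨w, hw⟩ : V) ^ 2 = ‖w‖ ^ 2 :=
      b.sum_sq_inner_right (⟨w, hw⟩ : V)
    have h3 := Finset.sum_mul_sq_le_sq_mul_sq Finset.univ (fun l => inner ℝ (b l) (⟨w, hw⟩ : V))
      (fun l => inner ℝ e (b l : EuclideanSpace ℝ (Fin n)))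
    rw [← h1, h2] at h3
    simp_rw [hin] at hcon
    -- Only the projection of the errors on `V` matters, so one chi-square event controls all `w` in
    -- `V` at once.
    have h4 : inner ℝ e w ^ 2 ≤ (x * ‖w‖) ^ 2 := by
      refine h3.trans ?_
      rw [mul_pow, mul_comm]
      gcongr
    exact absurd hlt (not_lt.2 (abs_le_of_sq_le_sq' h4 (by positivity)).2)
  · gcongr
    norm_num

end IsNoise

end Gaussian

/-! ### Matrix norms and quadratic forms. -/

section Euclidean

variable {ι κ : Type*} [Fintype ι] [Fintype κ]

lemma inner_toLp (x y : ι → ℝ) : inner ℝ (WithLp.toLp 2 x) (WithLp.toLp 2 y) = x ⬝ᵥ y := by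
  simp [PiLp.inner_apply, dotProduct, mul_comm]

lemma inner_eq_dotProduct (x y : EuclideanSpace ℝ ι) : inner ℝ x y = x.ofLp ⬝ᵥ y.ofLp :=
  inner_toLp x.ofLp y.ofLp

lemma enorm2_eq_norm (x : ι → ℝ) : enorm2 x = ‖WithLp.toLp 2 x‖ := by
  rw [enorm2, ← inner_toLp, real_inner_self_eq_norm_sq, Real.sqrt_sq (norm_nonneg _)]

/-- Compactness of the unit sphere makes the real supremum a genuine upper bound; homogeneity does
the rest. -/
lemma enorm2_mulVec_le (B : Matrix ι κ ℝ) (x : κ → ℝ) :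
    enorm2 (B *ᵥ x) ≤ normInfTwo B * ‖x‖ := by
  have hcont : Continuous fun x : κ → ℝ => enorm2 (B *ᵥ x) := by
    unfold enorm2
    fun_prop
  have hbdd : BddAbove (Set.range fun x : {x : κ → ℝ // ‖x‖ = 1} => enorm2 (B *ᵥ x.1)) := by
    have := ((isCompact_sphere (0 : κ → ℝ) 1).image hcont).bddAbove
    refine this.mono ?_
    rintro _ ⟨x, rfl⟩
    exact ⟨x.1, by simpa using x.2, rfl⟩
  rcases eq_or_ne x 0 with rfl | hx
  · simp [enorm2]
  · have hx0 : ‖x‖ ≠ 0 := norm_ne_zero_iff.2 hx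
    have h1 : enorm2 (B *ᵥ (‖x‖⁻¹ • x)) ≤ normInfTwo B :=
      le_ciSup hbdd ⟨‖x‖⁻¹ • x, by rw [norm_smul, norm_inv, norm_norm, inv_mul_cancel₀ hx0]⟩
    rw [Matrix.mulVec_smul, enorm2_eq_norm, WithLp.toLp_smul, norm_smul, norm_inv, norm_norm,
      ← enorm2_eq_norm, inv_mul_le_iff₀ (by positivity), mul_comm] at h1
    exact h1

lemma normInfTwo_nonneg (B : Matrix ι κ ℝ) : 0 ≤ normInfTwo B :=
  Real.iSup_nonneg fun _ => Real.sqrt_nonneg _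

/-- Eigenvalue bounds of a symmetric matrix as bounds of its quadratic form. -/
lemma quadratic_form_bounds [DecidableEq ι] {S : Matrix ι ι ℝ} (hS : S.IsHermitian) {c d : ℝ}
    (h : ∀ μ ∈ spectrum ℝ S, c ≤ μ ∧ μ ≤ d) (x : ι → ℝ) :
    c * (x ⬝ᵥ x) ≤ x ⬝ᵥ (S *ᵥ x) ∧ x ⬝ᵥ (S *ᵥ x) ≤ d * (x ⬝ᵥ x) := by
  have hdiag : ∀ c : ℝ, (algebraMap ℝ (Matrix ι ι ℝ) c).IsHermitian := by
    intro c
    rw [Algebra.algebraMap_eq_smul_one]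
    simp [Matrix.IsHermitian]
  have hval : ∀ c : ℝ, x ⬝ᵥ (algebraMap ℝ (Matrix ι ι ℝ) c *ᵥ x) = c * (x ⬝ᵥ x) := by
    intro c
    rw [Algebra.algebraMap_eq_smul_one, Matrix.smul_mulVec, Matrix.one_mulVec, dotProduct_smul,
      smul_eq_mul]
  constructor
  · have hpsd : (S - algebraMap ℝ _ c).PosSemidef := by
      rw [Matrix.posSemidef_iff_isHermitian_and_spectrum_nonneg]
      refine ⟨hS.sub (hdiag c), fun μ hμ => ?_⟩
      rw [← spectrum.sub_singleton_eq] at hμ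
      obtain ⟨ν, hν, _, rfl, rfl⟩ := Set.mem_sub.1 hμ
      simpa using (h ν hν).1
    have := hpsd.dotProduct_mulVec_nonneg x
    rw [star_trivial, Matrix.sub_mulVec, dotProduct_sub, hval] at this
    linarith
  · have hpsd : (algebraMap ℝ _ d - S).PosSemidef := by
      rw [Matrix.posSemidef_iff_isHermitian_and_spectrum_nonneg]
      refine ⟨(hdiag d).sub hS, fun μ hμ => ?_⟩
      rw [← spectrum.singleton_sub_eq] at hμ
      obtain ⟨_, rfl, ν, hν, rfl⟩ := Set.mem_sub.1 hμ
      simpa using (h ν hν).2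
    have := hpsd.dotProduct_mulVec_nonneg x
    rw [star_trivial, Matrix.sub_mulVec, dotProduct_sub, hval] at this
    linarith

end Euclidean

/-! ### The criterion split into signal and noise predictors. -/

namespace Setting

variable (M : Setting) (n : ℕ)

/-- Coefficient vectors of the signal predictors. -/
abbrev Coefs : Type := EuclideanSpace ℝ (M.active n × Fin (M.q n))

/-- The map `z ↦ Θⱼ z / √n`. -/
def componentMap (j : Fin (M.p n)) : (Fin (M.q n) → ℝ) →L[ℝ] EuclideanSpace ℝ (Fin n) :=
  LinearMap.toContinuousLinearMap
    ((√n)⁻¹ • ((WithLp.linearEquiv 2 ℝ (Fin n → ℝ)).symm.toLinearMap ∘ₗ (M.design n j).mulVecLin))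

lemma componentMap_apply (j : Fin (M.p n)) (z : Fin (M.q n) → ℝ) :
    M.componentMap n j z = (√n)⁻¹ • WithLp.toLp 2 (M.design n j *ᵥ z) := rfl

/-- The block of a coefficient vector that belongs to a signal predictor. -/
def blockProj (k : M.active n) : M.Coefs n →L[ℝ] (Fin (M.q n) → ℝ) :=
  LinearMap.toContinuousLinearMap
    { toFun := fun x l => x (k, l)
      map_add' := fun _ _ => rfl
      map_smul' := fun _ _ => rfl }

lemma blockProj_apply (k : M.active n) (x : M.Coefs n) (l : Fin (M.q n)) :
    M.blockProj n k x l = x (k, l) := rfl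

/-- The map `x ↦ Θ_k x_k / √n` for a signal predictor. -/
def blockMap (k : M.active n) : M.Coefs n →L[ℝ] EuclideanSpace ℝ (Fin n) :=
  (M.componentMap n k).comp (M.blockProj n k)

lemma blockMap_apply (k : M.active n) (x : M.Coefs n) :
    M.blockMap n k x = M.componentMap n k (M.blockProj n k x) := rfl

lemma norm_componentMap (j : Fin (M.p n)) (z : Fin (M.q n) → ℝ) :
    ‖M.componentMap n j z‖ = 1 / √n * enorm2 (M.design n j *ᵥ z) := by
  rw [componentMap_apply, norm_smul, enorm2_eq_norm, norm_inv,
    Real.norm_of_nonneg (Real.sqrt_nonneg _), one_div]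

lemma sum_blockMap (x : M.Coefs n) :
    ∑ k, M.blockMap n k x = (√n)⁻¹ • WithLp.toLp 2 (M.designActive n *ᵥ x.ofLp) := by
  simp only [blockMap_apply, componentMap_apply, ← Finset.smul_sum]
  congr 1
  ext i
  simp only [WithLp.ofLp_sum, Finset.sum_apply, Matrix.mulVec, dotProduct, designActive,
    Matrix.of_apply, blockProj_apply, Fintype.sum_prod_type]

/-- The signal part of a family of coefficient vectors. -/
def signalPart (η : Fin (M.p n) → Fin (M.q n) → ℝ) : M.Coefs n :=
  WithLp.toLp 2 fun kl => η kl.1 kl.2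

lemma blockProj_signalPart (η : Fin (M.p n) → Fin (M.q n) → ℝ) (k : M.active n) :
    M.blockProj n k (M.signalPart n η) = η k := rfl

/-- Extension of coefficients of the signal predictors by `0`. -/
def extend (x : M.Coefs n) : Fin (M.p n) → Fin (M.q n) → ℝ :=
  fun j l => if h : j ∈ M.active n then x (⟨j, h⟩, l) else 0

lemma extend_of_mem (x : M.Coefs n) (k : M.active n) :
    M.extend n x k = M.blockProj n k x := by
  funext l
  simp [extend, blockProj_apply]

lemma extend_of_notMem (x : M.Coefs n) {j : Fin (M.p n)} (hj : j ∉ M.active n) :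
    M.extend n x j = 0 := by
  funext l
  simp [extend, hj]

lemma signalPart_extend (x : M.Coefs n) : M.signalPart n (M.extend n x) = x := by
  ext ⟨k, l⟩
  simp [signalPart, extend]

lemma continuous_extend : Continuous (M.extend n) := by
  refine continuous_pi fun j => continuous_pi fun l => ?_
  unfold extend
  split_ifs <;> fun_prop

/-- The response, normalized by `√n`. -/
def scaled (Y : Fin n → ℝ) : EuclideanSpace ℝ (Fin n) := (√n)⁻¹ • WithLp.toLp 2 Y

lemma continuous_signalPart : Continuous (M.signalPart n) := by
  unfold signalPart
  fun_prop

lemma sum_split {β : Type*} [AddCommMonoid β] (f : Fin (M.p n) → β) :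
    ∑ j, f j = ∑ k : M.active n, f k + ∑ j : {j // j ∉ M.active n}, f j := by
  rw [← Fintype.sum_subtype_add_sum_subtype (fun j => j ∈ M.active n) f]
  congr!

/-- Absorbing `1 / √n` into the design and the response brings the criterion into the abstract form
treated above. -/
lemma criterion_eq (hn : 0 < n) (ρ : ℝ → ℝ) (Y : Fin n → ℝ) (η : Fin (M.p n) → Fin (M.q n) → ℝ) :
    criterion ρ (M.design n) Y η =
      1 / 2 * ‖scaled n Y - ∑ k, M.blockMap n k (M.signalPart n η) -
          ∑ j : {j // j ∉ M.active n}, M.componentMap n j (η j)‖ ^ 2 +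
        ∑ k, ρ ‖M.blockMap n k (M.signalPart n η)‖ +
        ∑ j : {j // j ∉ M.active n}, ρ ‖M.componentMap n j (η j)‖ := by
  have h1 : scaled n Y - ∑ k, M.blockMap n k (M.signalPart n η) -
      ∑ j : {j // j ∉ M.active n}, M.componentMap n j (η j) =
      (√n)⁻¹ • WithLp.toLp 2 (Y - ∑ j, M.design n j *ᵥ η j) := by
    rw [sub_sub]
    simp only [blockMap_apply, blockProj_signalPart]
    rw [← M.sum_split n fun j => M.componentMap n j (η j)]
    simp only [componentMap_apply, scaled, WithLp.toLp_sub, WithLp.toLp_sum, smul_sub,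
      Finset.smul_sum]
  have hn' : (0 : ℝ) < n := by exact_mod_cast hn
  rw [h1, norm_smul, mul_pow, norm_inv, Real.norm_of_nonneg (Real.sqrt_nonneg _), inv_pow,
    Real.sq_sqrt hn'.le, criterion, enorm2_eq_norm]
  simp only [blockMap_apply, blockProj_signalPart, add_assoc]
  rw [← M.sum_split n fun j => ρ ‖M.componentMap n j (η j)‖]
  simp only [norm_componentMap]
  congr 1
  field_simp

/-- A strict local minimizer of the split criterion is a FAR estimate. -/
lemma isFAREstimate_extend (hn : 0 < n) {Y : Fin n → ℝ} {x : M.Coefs n}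
    (h : ∀ᶠ z : M.Coefs n × ({j // j ∉ M.active n} → Fin (M.q n) → ℝ) in 𝓝 (x, 0), z ≠ (x, 0) →
      penalizedLoss (M.ρ (M.lam n)) (M.blockMap n) (scaled n Y) x +
          ∑ _j : {j // j ∉ M.active n}, M.ρ (M.lam n) 0 <
        1 / 2 * ‖scaled n Y - ∑ k, M.blockMap n k z.1 -
            ∑ j : {j // j ∉ M.active n}, M.componentMap n j (z.2 j)‖ ^ 2 +
          ∑ k, M.ρ (M.lam n) ‖M.blockMap n k z.1‖ +
          ∑ j : {j // j ∉ M.active n}, M.ρ (M.lam n) ‖M.componentMap n j (z.2 j)‖) :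
    M.IsFAREstimate n Y (M.extend n x) := by
  set Φ : (Fin (M.p n) → Fin (M.q n) → ℝ) →
      M.Coefs n × ({j // j ∉ M.active n} → Fin (M.q n) → ℝ) :=
    fun η => (M.signalPart n η, fun j => η j) with hΦ
  have hc : Continuous Φ := by
    refine (M.continuous_signalPart n).prodMk ?_
    fun_prop
  have h0 : Φ (M.extend n x) = (x, 0) := by
    refine Prod.ext (M.signalPart_extend n x) ?_
    funext j
    exact M.extend_of_notMem n x j.2
  rw [← h0] at h
  have hev := (hc.tendsto (M.extend n x)).eventually h
  rw [h0] at hev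
  rw [IsFAREstimate, eventually_nhdsWithin_iff]
  filter_upwards [hev] with η hη hne
  -- The splitting `Φ` is injective, so a punctured neighbourhood is mapped into a punctured one.
  have hne' : Φ η ≠ (x, 0) := by
    intro heq
    refine hne ?_
    funext j l
    by_cases hj : j ∈ M.active n
    · have := congrArg (fun z => z.1 (⟨j, hj⟩, l)) heq
      simpa [hΦ, signalPart, extend, hj] using this
    · have := congrArg (fun z => z.2 ⟨j, hj⟩ l) heq
      simpa [hΦ, extend, hj] using this
  have := hη hne'
  rw [M.criterion_eq n hn, M.criterion_eq n hn, M.signalPart_extend]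
  refine lt_of_eq_of_lt ?_ this
  have hz : ∀ j : {j // j ∉ M.active n}, M.componentMap n j (M.extend n x j) = 0 := by
    intro j
    rw [M.extend_of_notMem n x j.2, map_zero]
  simp [hz, penalizedLoss]

end Setting

/-! ### Least squares on the signals and the irrepresentability condition. -/

namespace Setting

variable (M : Setting) (n : ℕ)

lemma isHermitian_gram : (M.gram n).IsHermitian := by
  unfold gram
  simpa using Matrix.isHermitian_conjTranspose_mul_self (M.designActive n)

lemma gram_transpose : (M.gram n)ᵀ = M.gram n := by
  simpa [Matrix.IsHermitian] using M.isHermitian_gram n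

lemma gram_inv_transpose : ((M.gram n)⁻¹)ᵀ = (M.gram n)⁻¹ := by
  rw [Matrix.transpose_nonsing_inv, M.gram_transpose]

lemma dotProduct_gram_mulVec (x y : M.active n × Fin (M.q n) → ℝ) :
    x ⬝ᵥ (M.gram n *ᵥ y) = (M.designActive n *ᵥ x) ⬝ᵥ (M.designActive n *ᵥ y) := by
  rw [gram, ← Matrix.mulVec_mulVec, Matrix.dotProduct_mulVec, Matrix.vecMul_transpose]

lemma inner_sum_blockMap (u : EuclideanSpace ℝ (Fin n)) (x : M.Coefs n) :
    inner ℝ u (∑ k, M.blockMap n k x) =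
      ((√n)⁻¹ • ((M.designActive n)ᵀ *ᵥ u.ofLp)) ⬝ᵥ x.ofLp := by
  rw [sum_blockMap, real_inner_smul_right, inner_eq_dotProduct, smul_dotProduct,
    Matrix.mulVec_transpose, ← Matrix.dotProduct_mulVec, smul_eq_mul]

lemma inner_sum_blockMap_sum_blockMap (hn : 0 < n) (x y : M.Coefs n) :
    inner ℝ (∑ k, M.blockMap n k x) (∑ k, M.blockMap n k y) =
      (n : ℝ)⁻¹ * (x.ofLp ⬝ᵥ (M.gram n *ᵥ y.ofLp)) := by
  have hn' : (0 : ℝ) < n := by exact_mod_cast hn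
  rw [sum_blockMap, sum_blockMap, real_inner_smul_left, real_inner_smul_right, inner_toLp,
    dotProduct_gram_mulVec, ← mul_assoc, ← mul_inv, Real.mul_self_sqrt hn'.le]

/-- The eigenvalue condition in terms of quadratic forms. -/
lemma wellConditioned (hn : 0 < n) {c : ℝ}
    (h : ∀ μ ∈ spectrum ℝ ((1 / n : ℝ) • M.gram n), c ≤ μ ∧ μ ≤ c⁻¹) :
    WellConditioned (M.blockMap n) c := by
  have hherm : ((1 / n : ℝ) • M.gram n).IsHermitian := by
    rw [Matrix.IsHermitian, Matrix.conjTranspose_smul, M.isHermitian_gram n]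
    simp
  have hform : ∀ x : M.Coefs n,
      x.ofLp ⬝ᵥ (((1 / n : ℝ) • M.gram n) *ᵥ x.ofLp) = ‖∑ k, M.blockMap n k x‖ ^ 2 := by
    intro x
    rw [← real_inner_self_eq_norm_sq, inner_sum_blockMap_sum_blockMap M n hn, Matrix.smul_mulVec,
      dotProduct_smul, smul_eq_mul, one_div]
  have hself : ∀ x : M.Coefs n, x.ofLp ⬝ᵥ x.ofLp = ‖x‖ ^ 2 := by
    intro x
    rw [← inner_eq_dotProduct, real_inner_self_eq_norm_sq]
  have hupper : ∀ x : M.Coefs n, ‖∑ k, M.blockMap n k x‖ ^ 2 ≤ c⁻¹ * ‖x‖ ^ 2 := by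
    intro x
    rw [← hform, ← hself]
    exact (quadratic_form_bounds hherm h x.ofLp).2
  refine ⟨fun x => ?_, hupper, fun x => ?_⟩
  · rw [← hform, ← hself]
    exact (quadratic_form_bounds hherm h x.ofLp).1
  -- The block bound is the joint upper bound applied to `x` with all other blocks set to zero; the
  -- squared norms of these vectors add up to that of `x`.
  · set mask : M.active n → M.Coefs n := fun k =>
      WithLp.toLp 2 fun kl => if kl.1 = k then x kl else 0 with hmask
    have h1 : ∀ k, ∑ k', M.blockMap n k' (mask k) = M.blockMap n k x := by
      intro k
      rw [Finset.sum_eq_single k]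
      · rw [blockMap_apply, blockMap_apply]
        congr 1
        funext l
        simp [blockProj_apply, hmask]
      · intro k' _ hk'
        have : M.blockProj n k' (mask k) = 0 := by
          funext l
          simp [blockProj_apply, hmask, hk']
        rw [blockMap_apply, this, map_zero]
      · simp
    have h2 : ∑ k, ‖mask k‖ ^ 2 = ‖x‖ ^ 2 := by
      simp only [EuclideanSpace.real_norm_sq_eq, Fintype.sum_prod_type, hmask]
      refine Finset.sum_congr rfl fun k _ => ?_
      rw [Finset.sum_eq_single k]
      · simp
      · intro k' _ hk'
        simp [hk']
      · simp
    calc ∑ k, ‖M.blockMap n k x‖ ^ 2 = ∑ k, ‖∑ k', M.blockMap n k' (mask k)‖ ^ 2 := by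
          simp only [h1]
      _ ≤ ∑ k, c⁻¹ * ‖mask k‖ ^ 2 := Finset.sum_le_sum fun k _ => hupper _
      _ = _ := by rw [← Finset.mul_sum, h2]

lemma isUnit_det_gram {c : ℝ} (hc : 0 < c)
    (h : ∀ μ ∈ spectrum ℝ ((1 / n : ℝ) • M.gram n), c ≤ μ ∧ μ ≤ c⁻¹) :
    IsUnit (M.gram n).det := by
  have h0 : (0 : ℝ) ∉ spectrum ℝ ((1 / n : ℝ) • M.gram n) := fun h0 => by linarith [(h 0 h0).1]
  rw [spectrum.zero_notMem_iff, Matrix.isUnit_iff_isUnit_det, Matrix.det_smul] at h0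
  exact (IsUnit.mul_iff.1 h0).2

variable {M n}

/-- The preimage of a coefficient functional under the normal equations. -/
lemma inner_normal_equation (hn : 0 < n) (hG : IsUnit (M.gram n).det)
    (w : M.active n × Fin (M.q n) → ℝ) (x : M.Coefs n) :
    inner ℝ (∑ k, M.blockMap n k (WithLp.toLp 2 ((n : ℝ) • ((M.gram n)⁻¹ *ᵥ w))))
      (∑ k, M.blockMap n k x) = w ⬝ᵥ x.ofLp := by
  have hn' : (n : ℝ) ≠ 0 := by exact_mod_cast hn.ne'
  rw [real_inner_comm, inner_sum_blockMap_sum_blockMap M n hn, Matrix.mulVec_smul,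
    Matrix.mulVec_mulVec, Matrix.mul_nonsing_inv _ hG, Matrix.one_mulVec, dotProduct_smul,
    smul_eq_mul, ← mul_assoc, inv_mul_cancel₀ hn', one_mul, dotProduct_comm]

variable (M n) in
/-- The least squares coefficients of a response on the signal predictors. -/
def leastSquares : EuclideanSpace ℝ (Fin n) →ₗ[ℝ] M.Coefs n :=
  (WithLp.linearEquiv 2 ℝ (M.active n × Fin (M.q n) → ℝ)).symm.toLinearMap ∘ₗ
    ((n : ℝ) • (M.gram n)⁻¹.mulVecLin) ∘ₗ ((√n)⁻¹ • (M.designActive n)ᵀ.mulVecLin) ∘ₗ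
    (WithLp.linearEquiv 2 ℝ (Fin n → ℝ)).toLinearMap

lemma leastSquares_apply (u : EuclideanSpace ℝ (Fin n)) :
    M.leastSquares n u = WithLp.toLp 2
      ((n : ℝ) • ((M.gram n)⁻¹ *ᵥ ((√n)⁻¹ • ((M.designActive n)ᵀ *ᵥ u.ofLp)))) := rfl

variable (M n) in
/-- The residual of a response after least squares on the signal predictors. -/
def lsResidual : EuclideanSpace ℝ (Fin n) →ₗ[ℝ] EuclideanSpace ℝ (Fin n) :=
  LinearMap.id - (∑ k, (M.blockMap n k).toLinearMap) ∘ₗ M.leastSquares n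

lemma lsResidual_apply (u : EuclideanSpace ℝ (Fin n)) :
    M.lsResidual n u = u - ∑ k, M.blockMap n k (M.leastSquares n u) := by
  simp [lsResidual]

lemma inner_lsResidual (hn : 0 < n) (hG : IsUnit (M.gram n).det) (u : EuclideanSpace ℝ (Fin n))
    (x : M.Coefs n) : inner ℝ (M.lsResidual n u) (∑ k, M.blockMap n k x) = 0 := by
  rw [lsResidual_apply, inner_sub_left, leastSquares_apply, inner_normal_equation hn hG,
    inner_sum_blockMap, sub_self]

lemma norm_lsResidual_le (hn : 0 < n) (hG : IsUnit (M.gram n).det)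
    (u : EuclideanSpace ℝ (Fin n)) : ‖M.lsResidual n u‖ ≤ ‖u‖ := by
  have h1 := inner_lsResidual hn hG u (M.leastSquares n u)
  have h2 : u = M.lsResidual n u + ∑ k, M.blockMap n k (M.leastSquares n u) := by
    rw [lsResidual_apply]; abel
  have h3 := norm_add_sq_real (M.lsResidual n u) (∑ k, M.blockMap n k (M.leastSquares n u))
  rw [← h2, h1] at h3
  refine abs_le_of_sq_le_sq' ?_ (norm_nonneg _) |>.2
  nlinarith [sq_nonneg ‖∑ k, M.blockMap n k (M.leastSquares n u)‖]

variable (M n) in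
/-- The part of the span of a predictor that is orthogonal to the signal predictors. -/
def noiseSpace (j : Fin (M.p n)) : Submodule ℝ (EuclideanSpace ℝ (Fin n)) :=
  (LinearMap.range (M.componentMap n j).toLinearMap).map (M.lsResidual n)

lemma finrank_noiseSpace_le (j : Fin (M.p n)) :
    Module.finrank ℝ (M.noiseSpace n j) ≤ M.q n :=
  (Submodule.finrank_map_le _ _).trans ((LinearMap.finrank_range_le _).trans (by simp))

lemma lsResidual_mem_noiseSpace (j : Fin (M.p n)) (z : Fin (M.q n) → ℝ) :
    M.lsResidual n (M.componentMap n j z) ∈ M.noiseSpace n j :=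
  Submodule.mem_map_of_mem (LinearMap.mem_range_self _ z)

variable (M n) in
/-- The matrix in the irrepresentability condition. -/
def irrepMatrix (j : Fin (M.p n)) : Matrix (Fin n) (M.active n × Fin (M.q n)) ℝ :=
  M.design n j * ((M.design n j)ᵀ * M.design n j)⁻¹ * (M.design n j)ᵀ * M.designActive n *
    (M.gram n)⁻¹

/-- A vector in the range of `Θⱼ` is fixed by the projection on that range. Inserting the projection
and transposing moves the irrepresentability matrix onto `v`, where its `(∞, 2)` norm applies. -/
lemma dotProduct_leastSquares_le {j : Fin (M.p n)}
    (hj : IsUnit ((M.design n j)ᵀ * M.design n j).det) {m : ℝ}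
    (v : M.active n × Fin (M.q n) → ℝ) (hv : ‖v‖ ≤ m) (z : Fin (M.q n) → ℝ) :
    v ⬝ᵥ (M.leastSquares n (M.componentMap n j z)).ofLp ≤
      √n * normInfTwo (M.irrepMatrix n j) * m * ‖M.componentMap n j z‖ := by
  set u := M.componentMap n j z with hu
  set D := M.design n j with hD
  have hproj : (D * (Dᵀ * D)⁻¹ * Dᵀ) *ᵥ u.ofLp = u.ofLp := by
    have : u.ofLp = D *ᵥ ((√n)⁻¹ • z) := by
      rw [hu, componentMap_apply, Matrix.mulVec_smul, WithLp.ofLp_smul]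
    rw [this, Matrix.mulVec_mulVec, Matrix.mul_assoc _ Dᵀ D, Matrix.mul_assoc D,
      Matrix.nonsing_inv_mul _ hj, Matrix.mul_one]
  have htr : (M.irrepMatrix n j)ᵀ =
      (M.gram n)⁻¹ * (M.designActive n)ᵀ * (D * (Dᵀ * D)⁻¹ * Dᵀ) := by
    have : ((Dᵀ * D)⁻¹)ᵀ = (Dᵀ * D)⁻¹ := by
      rw [Matrix.transpose_nonsing_inv, Matrix.transpose_mul, Matrix.transpose_transpose]
    rw [irrepMatrix]
    simp only [Matrix.transpose_mul, gram_inv_transpose, Matrix.transpose_transpose, ← hD, this,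
      Matrix.mul_assoc]
  have hn0 : (0 : ℝ) ≤ n := Nat.cast_nonneg n
  have hsq : (n : ℝ) * (√n)⁻¹ = √n := by
    rw [← div_eq_mul_inv, Real.div_sqrt]
  have h1 : v ⬝ᵥ (M.leastSquares n u).ofLp =
      √n * inner ℝ (WithLp.toLp 2 (M.irrepMatrix n j *ᵥ v)) u := by
    have h2 : M.irrepMatrix n j *ᵥ v ⬝ᵥ u.ofLp =
        v ⬝ᵥ ((M.gram n)⁻¹ *ᵥ ((M.designActive n)ᵀ *ᵥ u.ofLp)) := by
      rw [dotProduct_comm, Matrix.dotProduct_mulVec, ← Matrix.mulVec_transpose, htr,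
        ← Matrix.mulVec_mulVec, hproj, ← Matrix.mulVec_mulVec, dotProduct_comm]
    rw [inner_eq_dotProduct, h2, leastSquares_apply]
    simp only [Matrix.mulVec_smul, dotProduct_smul, smul_eq_mul]
    rw [← mul_assoc, hsq]
  rw [h1, mul_assoc, mul_assoc, ← mul_assoc (normInfTwo _)]
  refine mul_le_mul_of_nonneg_left ((real_inner_le_norm _ _).trans ?_) (Real.sqrt_nonneg _)
  rw [← enorm2_eq_norm]
  gcongr
  exact (enorm2_mulVec_le _ _).trans (mul_le_mul_of_nonneg_left hv (normInfTwo_nonneg _))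

/-- The correlation of the residual at a stationary point with a noise predictor. -/
lemma inner_residual_componentMap_le (hn : 0 < n) (hG : IsUnit (M.gram n).det) {c : ℝ}
    (hc : 0 < c) (hA : WellConditioned (M.blockMap n) c) {j : Fin (M.p n)}
    (hj : IsUnit ((M.design n j)ᵀ * M.design n j).det) {x x₀ : M.Coefs n}
    {e : EuclideanSpace ℝ (Fin n)} {g : M.active n → EuclideanSpace ℝ (Fin n)} {m : ℝ} (hm : 0 ≤ m)
    (hg : ∀ k, ‖g k‖ ≤ m)
    (hkkt : ∀ z, inner ℝ (∑ k, M.blockMap n k x₀ + e - ∑ k, M.blockMap n k x)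
      (∑ k, M.blockMap n k z) = ∑ k, inner ℝ (g k) (M.blockMap n k z)) (z : Fin (M.q n) → ℝ) :
    inner ℝ (∑ k, M.blockMap n k x₀ + e - ∑ k, M.blockMap n k x) (M.componentMap n j z) ≤
      inner ℝ e (M.lsResidual n (M.componentMap n j z)) +
        √n * normInfTwo (M.irrepMatrix n j) * (m / √c) * ‖M.componentMap n j z‖ := by
  set R := ∑ k, M.blockMap n k x₀ + e - ∑ k, M.blockMap n k x with hR
  set u := M.componentMap n j z
  set v := (√n)⁻¹ • ((M.designActive n)ᵀ *ᵥ R.ofLp) with hv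
  -- By stationarity, the coordinate of `v` at `(k, l)` pairs `g k` alone with one column, so its
  -- maximum norm does not grow with the number of signals.
  have hvb : ‖v‖ ≤ m / √c := by
    refine (pi_norm_le_iff_of_nonneg (by positivity)).2 fun kl => ?_
    have h1 : v kl = inner ℝ R (∑ k, M.blockMap n k (EuclideanSpace.single kl 1)) := by
      rw [inner_sum_blockMap]
      simp [hv]
    have h2 : ∀ k ∈ Finset.univ, k ≠ kl.1 →
        inner ℝ (g k) (M.blockMap n k (EuclideanSpace.single kl 1)) = 0 := by
      intro k _ hk
      have : M.blockProj n k (EuclideanSpace.single kl 1) = 0 := by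
        funext l
        simp [blockProj_apply, Prod.ext_iff, hk]
      rw [blockMap_apply, this, map_zero, inner_zero_right]
    have h3 : ‖M.blockMap n kl.1 (EuclideanSpace.single kl (1 : ℝ))‖ ≤ 1 / √c := by
      have h4 := (Finset.single_le_sum (f := fun k => ‖M.blockMap n k
        (EuclideanSpace.single kl (1 : ℝ))‖ ^ 2) (fun i _ => by positivity)
        (Finset.mem_univ kl.1)).trans (hA.block (EuclideanSpace.single kl (1 : ℝ)))
      refine abs_le_of_sq_le_sq' ?_ (by positivity) |>.2
      rw [div_pow, Real.sq_sqrt hc.le]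
      simpa using h4
    rw [h1, hkkt, Finset.sum_eq_single kl.1 h2 (by simp), Real.norm_eq_abs]
    refine (abs_real_inner_le_norm _ _).trans ?_
    calc _ ≤ m * (1 / √c) := mul_le_mul (hg _) h3 (norm_nonneg _) hm
      _ = _ := by ring
  have hsplit : u = M.lsResidual n u + ∑ k, M.blockMap n k (M.leastSquares n u) := by
    rw [lsResidual_apply]; abel
  have h5 : inner ℝ R u = inner ℝ R (M.lsResidual n u) +
      inner ℝ R (∑ k, M.blockMap n k (M.leastSquares n u)) := by
    rw [← inner_add_right, ← hsplit]
  -- The fitted and the true signal differ by an element of the signal span, which the least squares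
  -- residual does not see.
  have h6 : inner ℝ R (M.lsResidual n u) = inner ℝ e (M.lsResidual n u) := by
    have : R = e + ∑ k, M.blockMap n k (x₀ - x) := by
      simp only [hR, map_sub, Finset.sum_sub_distrib]; abel
    rw [this, inner_add_left, real_inner_comm (M.lsResidual n u) (∑ k, _),
      inner_lsResidual hn hG, add_zero]
  rw [h5, h6, inner_sum_blockMap]
  exact add_le_add_right (dotProduct_leastSquares_le hj v hvb z) _

end Setting

/-! ### Truncation bias and the deterministic analysis at a fixed sample size. -/

namespace Setting

variable (M : Setting) (n : ℕ)

/-- The true coefficients of the signal predictors. -/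
def trueSignal : M.Coefs n := M.signalPart n (M.trueCoef n)

/-- The error made by truncating the basis expansions. -/
def bias : Fin n → ℝ :=
  (fun i => ∑ j, inner ℝ (M.X n i j) (M.β n j)) - M.designActive n *ᵥ (M.trueSignal n).ofLp

lemma scaled_response (e : Fin n → ℝ) :
    scaled n (M.response n e) =
      ∑ k, M.blockMap n k (M.trueSignal n) + (scaled n (M.bias n) + scaled n e) := by
  rw [sum_blockMap, scaled, scaled, scaled, ← smul_add, ← smul_add, ← WithLp.toLp_add,
    ← WithLp.toLp_add]
  congr 2
  funext i
  simp only [response, bias, Pi.add_apply, Pi.sub_apply]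
  ring

lemma a_le_norm_blockMap (k : M.active n) : M.a n ≤ ‖M.blockMap n k (M.trueSignal n)‖ := by
  rw [blockMap_apply, trueSignal, blockProj_signalPart, norm_componentMap]
  exact ciInf_le (Set.finite_range _).bddBelow k

lemma two_mul_le_norm_blockMap (k : M.active n) :
    2 * (M.a n / 2) ≤ ‖M.blockMap n k (M.trueSignal n)‖ := by
  linarith [M.a_le_norm_blockMap n k]

lemma hasSum_coef (x y : L2) : HasSum (fun l => M.coef l x * M.coef l y) (inner ℝ x y) := by
  have := M.b.hasSum_inner_mul_inner x y
  refine this.congr_fun fun l => ?_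
  rw [coef, coef, real_inner_comm x]

variable {M n}

/-- Cauchy–Schwarz on the tail: for `l ≥ q` the Sobolev weight is at least `q ^ 4`, and Bessel's
inequality bounds the other factor. Finite tails are estimated first and passed to the limit. -/
lemma abs_inner_sub_sum_coef_le {C Ct : ℝ} {x y : L2}
    (hx : Summable fun l : ℕ => M.coef l x ^ 2 * ((l : ℝ) + 1) ^ 4)
    (hxC : ∑' l : ℕ, M.coef l x ^ 2 * ((l : ℝ) + 1) ^ 4 ≤ C ^ 2) (hy : ‖y‖ ^ 2 ≤ Ct) {q : ℕ}
    (hq : 0 < q) :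
    |inner ℝ x y - ∑ l ∈ Finset.range q, M.coef l x * M.coef l y| ≤
      √(C ^ 2) * √Ct * ((q : ℝ) ^ 2)⁻¹ := by
  have hlim := ((M.hasSum_coef x y).tendsto_sum_nat.sub_const
    (∑ l ∈ Finset.range q, M.coef l x * M.coef l y)).abs
  refine le_of_tendsto hlim ?_
  filter_upwards [eventually_ge_atTop q] with N hN
  rw [← Finset.sum_Ico_eq_sub _ hN]
  have hq' : (0 : ℝ) < q := by exact_mod_cast hq
  have h1 : ∑ l ∈ Finset.Ico q N, M.coef l x ^ 2 ≤ C ^ 2 * ((q : ℝ) ^ 4)⁻¹ := by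
    rw [← div_eq_mul_inv, le_div_iff₀ (by positivity)]
    refine le_trans ?_ ((hx.sum_le_tsum (Finset.Ico q N) fun l _ => by positivity).trans hxC)
    rw [Finset.sum_mul]
    refine Finset.sum_le_sum fun l hl => ?_
    have : (q : ℝ) ≤ l + 1 := by
      have := (Finset.mem_Ico.1 hl).1
      exact_mod_cast this.trans (Nat.le_succ l)
    gcongr
  have h2 : ∑ l ∈ Finset.Ico q N, M.coef l y ^ 2 ≤ Ct := by
    refine le_trans ?_ hy
    have := M.b.orthonormal.sum_inner_products_le (s := Finset.Ico q N) y
    simpa [coef] using this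
  have hCt : 0 ≤ Ct := (sq_nonneg _).trans hy
  have h3 := Finset.sum_mul_sq_le_sq_mul_sq (Finset.Ico q N) (fun l => M.coef l x)
    (fun l => M.coef l y)
  refine abs_le_of_sq_le_sq ?_ (by positivity)
  refine h3.trans ?_
  calc _ ≤ (C ^ 2 * ((q : ℝ) ^ 4)⁻¹) * Ct :=
        mul_le_mul h1 h2 (Finset.sum_nonneg fun _ _ => sq_nonneg _) (by positivity)
    _ = _ := by
      rw [mul_pow, mul_pow, Real.sq_sqrt (sq_nonneg C), Real.sq_sqrt hCt]
      have : ((q : ℝ) ^ 4)⁻¹ = (((q : ℝ) ^ 2)⁻¹) ^ 2 := by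
        rw [inv_pow, ← pow_mul]
      rw [this]
      ring

/-- The standardization cancels. If the scale is zero, the whole column of coefficients vanishes, so
division by zero does no harm. -/
lemma design_mul_trueCoef (i : Fin n) (j : Fin (M.p n)) (l : Fin (M.q n)) :
    M.design n j i l * M.trueCoef n j l = M.coef l (M.X n i j) * M.coef l (M.β n j) := by
  have hn : 0 < n := i.pos
  have hn' : (0 : ℝ) < n := by exact_mod_cast hn
  simp only [design, trueCoef, Matrix.of_apply]
  rcases eq_or_ne (M.scale n j l) 0 with h0 | h0
  · rw [scale, Real.sqrt_eq_zero (by positivity), div_eq_zero_iff, or_iff_left hn'.ne',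
      Finset.sum_eq_zero_iff_of_nonneg fun _ _ => sq_nonneg _] at h0
    have := pow_eq_zero_iff (two_ne_zero) |>.1 (h0 i (Finset.mem_univ i))
    simp [this]
  · field_simp

lemma norm_sq_eq_integral (x : L2) : ‖x‖ ^ 2 = ∫ t in Set.Icc (0 : ℝ) 1, x t ^ 2 := by
  rw [← real_inner_self_eq_norm_sq, L2.inner_def]
  refine integral_congr_ae (ae_of_all _ fun t => ?_)
  simp [pow_two]

lemma Smooth.abs_bias_le {C Ct : ℝ} (h : M.Smooth C Ct) (hq : 0 < M.q n) (i : Fin n) :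
    |M.bias n i| ≤ √(C ^ 2) * √Ct * (M.s n * ((M.q n : ℝ) ^ 2)⁻¹) := by
  have hz : ∀ j : {j // j ∉ M.active n}, inner ℝ (M.X n i j) (M.β n j) = 0 := by
    intro j
    have : M.β n j = 0 := by
      have := j.2
      simpa [active] using this
    rw [this, inner_zero_right]
  have hb : M.bias n i = ∑ k : M.active n, (inner ℝ (M.X n i k) (M.β n k) -
      ∑ l ∈ Finset.range (M.q n), M.coef l (M.X n i k) * M.coef l (M.β n k)) := by
    rw [Finset.sum_sub_distrib]
    simp only [bias, Pi.sub_apply]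
    rw [M.sum_split n fun j => inner ℝ (M.X n i j) (M.β n j)]
    simp only [hz, Finset.sum_const_zero, add_zero]
    congr 1
    simp only [Matrix.mulVec, dotProduct, Fintype.sum_prod_type, designActive, Matrix.of_apply,
      trueSignal, signalPart, design_mul_trueCoef]
    refine Finset.sum_congr rfl fun k _ => ?_
    exact Fin.sum_univ_eq_sum_range
      (fun l => M.coef l (M.X n i k) * M.coef l (M.β n k)) (M.q n)
  rw [hb]
  refine (Finset.abs_sum_le_sum_abs _ _).trans ?_
  calc _ ≤ ∑ _k : M.active n, √(C ^ 2) * √Ct * ((M.q n : ℝ) ^ 2)⁻¹ := by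
        refine Finset.sum_le_sum fun k _ => ?_
        obtain ⟨h1, h2⟩ := h.sobolev n i k
        refine abs_inner_sub_sum_coef_le h1 h2 ?_ hq
        rw [norm_sq_eq_integral]
        exact h.bounded n k k.2
    _ = _ := by
        rw [Finset.sum_const, Finset.card_univ, Fintype.card_coe, nsmul_eq_mul, s]
        ring

lemma norm_scaled_le (hn : 0 < n) {Y : Fin n → ℝ} {b : ℝ} (hb : 0 ≤ b) (hY : ∀ i, |Y i| ≤ b) :
    ‖scaled n Y‖ ≤ b := by
  have hn' : (0 : ℝ) < n := by exact_mod_cast hn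
  refine abs_le_of_sq_le_sq' ?_ hb |>.2
  rw [scaled, norm_smul, mul_pow, norm_inv, Real.norm_of_nonneg (Real.sqrt_nonneg _), inv_pow,
    Real.sq_sqrt hn'.le, EuclideanSpace.real_norm_sq_eq, inv_mul_le_iff₀ hn']
  calc ∑ i, Y i ^ 2 ≤ ∑ _i : Fin n, b ^ 2 :=
        Finset.sum_le_sum fun i _ => sq_le_sq.2 (by rw [abs_of_nonneg hb]; exact hY i)
    _ = _ := by simp

variable (M n)

/-- The deterministic requirements at a sample size `n`: `r` is the localization radius, `b` bounds
the truncation bias and `B` bounds the curvature of the penalty. -/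
structure Tuned (c κ r b B : ℝ) : Prop where
  n_pos : 0 < n
  mild : MildPenalty (M.ρ (M.lam n)) c (M.a n / 2)
  concave : ConcaveOn ℝ (Set.Ici 0) (M.ρ (M.lam n))
  conditioned : WellConditioned (M.blockMap n) c
  gram_unit : IsUnit (M.gram n).det
  noise_unit : ∀ j ∉ M.active n, IsUnit ((M.design n j)ᵀ * M.design n j).det
  radius_pos : 0 < r
  radius_le : r ≤ √c * (M.a n / 2)
  bias_le : ‖scaled n (M.bias n)‖ ≤ b
  gradient_small : (c / 8 * r + b / √c) +
    deriv (M.ρ (M.lam n)) (M.a n / 2) * (√(M.s n) / √c) < c / 2 * r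
  lam_pos : 0 < κ * M.lam n
  bias_lam : b ≤ κ * M.lam n / 8
  slope_ge : ((κ * M.lam n : ℝ) : EReal) ≤ slopeZero (M.ρ (M.lam n))
  irrepresentable : ∀ j ∉ M.active n,
    ((2 * √n * normInfTwo (M.irrepMatrix n j) *
      deriv (M.ρ (M.lam n)) (M.a n / 2) : ℝ) : EReal) <
    ((√c : ℝ) : EReal) * slopeZero (M.ρ (M.lam n))
  curvature : ∀ t ≥ M.a n / 2, |deriv (deriv (M.ρ (M.lam n))) t| ≤ B

/-- The errors have small correlation with all predictors. -/
structure Quiet (c κ r : ℝ) (e : Fin n → ℝ) : Prop where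
  signal : ∀ z, inner ℝ (scaled n e) (∑ k, M.blockMap n k z) ≤ c / 8 * r * ‖z‖
  noise : ∀ j ∉ M.active n, ∀ w ∈ M.noiseSpace n j,
    inner ℝ (WithLp.toLp 2 e) w ≤ √n * (κ * M.lam n / 8) * ‖w‖

/-- `x` minimizes the criterion for the responses with errors `e` over the closed ball of radius `r`
around the true coefficients, with quadratic growth. -/
structure LocalMin (c r : ℝ) (e : Fin n → ℝ) (x : M.Coefs n) : Prop where
  mem : x ∈ Metric.closedBall (M.trueSignal n) r
  growth : ∀ z ∈ Metric.closedBall (M.trueSignal n) r,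
    penalizedLoss (M.ρ (M.lam n)) (M.blockMap n) (scaled n (M.response n e)) x +
      c / 8 * ‖z - x‖ ^ 2 ≤
    penalizedLoss (M.ρ (M.lam n)) (M.blockMap n) (scaled n (M.response n e)) z

variable {M n} {c κ r b B : ℝ}

/-- The slope at `0+` may be infinite or not attained, but the finitely many irrepresentability
bounds are strict and `κ λ / 2 < κ λ`, so all survive at a small positive `t`. -/
lemma Tuned.exists_slope (h : M.Tuned n c κ r b B) :
    ∃ t > 0, κ * M.lam n / 2 < deriv (M.ρ (M.lam n)) t ∧ ∀ j ∉ M.active n,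
      2 * √n * normInfTwo (M.irrepMatrix n j) * deriv (M.ρ (M.lam n)) (M.a n / 2) <
        √c * deriv (M.ρ (M.lam n)) t := by
  have hc := Real.sqrt_pos.2 h.mild.pos
  have hlt : ∀ y : ℝ, (y : EReal) < slopeZero (M.ρ (M.lam n)) →
      ∀ᶠ t in 𝓝[>] (0 : ℝ), y < deriv (M.ρ (M.lam n)) t := by
    intro y hy
    obtain ⟨t, ht⟩ := lt_iSup_iff.1 hy
    filter_upwards [Ioo_mem_nhdsGT t.2] with u hu
    have : y < deriv (M.ρ (M.lam n)) t := by exact_mod_cast ht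
    exact this.trans_le (h.mild.antitone_deriv hu.1 t.2 hu.2.le)
  have h1 := hlt (κ * M.lam n / 2) (lt_of_lt_of_le
    (by exact_mod_cast (by linarith [h.lam_pos] : κ * M.lam n / 2 < κ * M.lam n)) h.slope_ge)
  have h2 : ∀ᶠ t in 𝓝[>] (0 : ℝ), ∀ j ∉ M.active n,
      2 * √n * normInfTwo (M.irrepMatrix n j) * deriv (M.ρ (M.lam n)) (M.a n / 2) <
        √c * deriv (M.ρ (M.lam n)) t := by
    refine eventually_all.2 fun j => eventually_imp_distrib_left.2 fun hj => ?_
    set y := 2 * √n * normInfTwo (M.irrepMatrix n j) * deriv (M.ρ (M.lam n)) (M.a n / 2) with hy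
    have h3 : ((y / √c : ℝ) : EReal) < slopeZero (M.ρ (M.lam n)) := by
      by_contra! hle
      have h4 := mul_le_mul_of_nonneg_left hle
        (by exact_mod_cast hc.le : (0 : EReal) ≤ ((√c : ℝ) : EReal))
      rw [← EReal.coe_mul, mul_div_cancel₀ _ hc.ne'] at h4
      exact absurd (h.irrepresentable j hj) (not_lt.2 h4)
    filter_upwards [hlt _ h3] with t ht
    rwa [div_lt_iff₀' hc] at ht
  obtain ⟨t, ⟨ht1, ht2⟩, ht3⟩ := ((h1.and h2).and self_mem_nhdsWithin).exists
  exact ⟨t, ht3, ht1, ht2⟩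

lemma Tuned.mem_ball (h : M.Tuned n c κ r b B) {e : Fin n → ℝ} (he : M.Quiet n c κ r e)
    {x : M.Coefs n} (hx : M.LocalMin n c r e x) : x ∈ Metric.ball (M.trueSignal n) r := by
  have hc := h.mild.pos
  have hg := hx.growth
  rw [scaled_response] at hg
  refine mem_ball_of_minimizer (τ := c / 8 * r + b / √c) h.mild h.conditioned
    (M.two_mul_le_norm_blockMap n) h.radius_pos h.radius_le hx.mem ?_ ?_ ?_
    (e := scaled n (M.bias n) + scaled n e)
  · have := hg _ (Metric.mem_closedBall_self h.radius_pos.le)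
    have h0 : 0 ≤ c / 8 * ‖M.trueSignal n - x‖ ^ 2 := by positivity
    linarith
  · intro z
    have h1 : ‖∑ k, M.blockMap n k z‖ ≤ ‖z‖ / √c := by
      refine abs_le_of_sq_le_sq' ?_ (by positivity) |>.2
      rw [div_pow, Real.sq_sqrt hc.le, div_eq_inv_mul]
      exact h.conditioned.upper z
    have h2 : inner ℝ (scaled n (M.bias n)) (∑ k, M.blockMap n k z) ≤ b * (‖z‖ / √c) :=
      (real_inner_le_norm _ _).trans
        (mul_le_mul h.bias_le h1 (norm_nonneg _) ((norm_nonneg _).trans h.bias_le))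
    rw [inner_add_left]
    have h3 := he.signal z
    calc _ ≤ b * (‖z‖ / √c) + c / 8 * r * ‖z‖ := add_le_add h2 h3
      _ = _ := by ring
  · have := h.gradient_small
    rwa [Fintype.card_coe]

lemma Tuned.le_norm_blockMap (h : M.Tuned n c κ r b B) {x : M.Coefs n}
    (hx : x ∈ Metric.closedBall (M.trueSignal n) r) (k : M.active n) :
    M.a n / 2 ≤ ‖M.blockMap n k x‖ :=
  h.conditioned.le_norm_apply h.mild.pos (M.two_mul_le_norm_blockMap n) h.radius_le hx k

lemma Tuned.stationary (h : M.Tuned n c κ r b B) {e : Fin n → ℝ} (he : M.Quiet n c κ r e)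
    {x : M.Coefs n} (hx : M.LocalMin n c r e x) (z : M.Coefs n) :
    inner ℝ (∑ k, M.blockMap n k (M.trueSignal n) + (scaled n (M.bias n) + scaled n e) -
        ∑ k, M.blockMap n k x) (∑ k, M.blockMap n k z) =
      ∑ k, inner ℝ (penaltyGradient (M.ρ (M.lam n)) (M.blockMap n k x)) (M.blockMap n k z) := by
  rw [← scaled_response]
  refine inner_residual_eq_of_minimizer h.mild (h.le_norm_blockMap hx.mem) (h.mem_ball he hx)
    (fun z hz => ?_) z
  have := hx.growth z hz
  have hc := h.mild.pos
  have h0 : 0 ≤ c / 8 * ‖z - x‖ ^ 2 := by positivity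
  linarith

/-- On the event that the errors are quiet, the local minimizer is a FAR estimate. -/
theorem Tuned.isFAREstimate (h : M.Tuned n c κ r b B) {e : Fin n → ℝ} (he : M.Quiet n c κ r e)
    {x : M.Coefs n} (hx : M.LocalMin n c r e x) :
    M.IsFAREstimate n (M.response n e) (M.extend n x) := by
  have hc := h.mild.pos
  have hsc := Real.sqrt_pos.2 hc
  have hn' : (0 : ℝ) < n := by exact_mod_cast h.n_pos
  obtain ⟨t, ht, hlam, hirr⟩ := h.exists_slope
  refine M.isFAREstimate_extend n h.n_pos ?_
  -- The budget `L'` consists of `ρ'(t) / 2` for irrepresentability and `κ λ / 8` each for bias and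
  -- errors. It is below `L = ρ'(t)` because `κ λ / 2 < ρ'(t)`.
  refine eventually_penalizedLoss_lt (B := fun j : {j // j ∉ M.active n} => M.componentMap n j)
    (L := deriv (M.ρ (M.lam n)) t)
    (L' := deriv (M.ρ (M.lam n)) t / 2 + κ * M.lam n / 4) (t₁ := t)
    ?_ (by positivity : 0 < c / 8) (h.mem_ball he hx) hx.growth ht
    (fun u hu hut => add_deriv_mul_le_of_concaveOn h.concave h.mild.differentiable
      h.mild.antitone_deriv hu hut) (by linarith) ?_
  · intro j
    rw [injective_iff_map_eq_zero]
    intro z hz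
    have h1 : M.design n j *ᵥ z = 0 := by
      have := norm_componentMap M n j z
      rw [hz, norm_zero, enorm2_eq_norm] at this
      have h2 : ‖WithLp.toLp 2 (M.design n j *ᵥ z)‖ = 0 := by
        have h3 : 1 / √(n : ℝ) ≠ 0 := by positivity
        exact (mul_eq_zero.1 this.symm).resolve_left h3
      simpa using h2
    have h2 : ((M.design n j)ᵀ * M.design n j) *ᵥ z = 0 := by
      rw [← Matrix.mulVec_mulVec, h1, Matrix.mulVec_zero]
    have h3 := congrArg (((M.design n j)ᵀ * M.design n j)⁻¹ *ᵥ ·) h2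
    simpa [Matrix.mulVec_mulVec, Matrix.nonsing_inv_mul _ (h.noise_unit j j.2)] using h3
  · intro j z
    set u := M.componentMap n j z with hu
    rw [scaled_response]
    have hd := h.mild.deriv_nonneg h.mild.threshold_pos
    refine (inner_residual_componentMap_le h.n_pos h.gram_unit hc h.conditioned
      (h.noise_unit j j.2) hd
      (fun k => h.mild.norm_penaltyGradient_le (h.le_norm_blockMap hx.mem k))
      (h.stationary he hx) z).trans ?_
    rw [← hu]
    have hres := norm_lsResidual_le h.n_pos h.gram_unit u
    have hk : 0 ≤ κ * M.lam n / 8 := by linarith [h.lam_pos]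
    have h1 : inner ℝ (scaled n (M.bias n)) (M.lsResidual n u) ≤ κ * M.lam n / 8 * ‖u‖ :=
      (real_inner_le_norm _ _).trans
        (mul_le_mul (h.bias_le.trans h.bias_lam) hres (norm_nonneg _) hk)
    have h2 : inner ℝ (scaled n e) (M.lsResidual n u) ≤ κ * M.lam n / 8 * ‖u‖ := by
      rw [scaled, real_inner_smul_left]
      have h3 := he.noise j j.2 _ (lsResidual_mem_noiseSpace (j : Fin (M.p n)) z)
      rw [inv_mul_le_iff₀ (Real.sqrt_pos.2 hn'), ← mul_assoc]
      exact h3.trans (mul_le_mul_of_nonneg_left hres (by positivity))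
    have h3 : √n * normInfTwo (M.irrepMatrix n j) *
        (deriv (M.ρ (M.lam n)) (M.a n / 2) / √c) ≤ deriv (M.ρ (M.lam n)) t / 2 := by
      rw [← mul_div_assoc, div_le_iff₀ hsc]
      linarith [hirr j j.2]
    have h4 := mul_le_mul_of_nonneg_right h3 (norm_nonneg u)
    rw [inner_add_left]
    linarith

/-- The linear expansion of the estimated values at a new observation. -/
theorem Tuned.abs_expansion_le (h : M.Tuned n c κ r b B) {e : Fin n → ℝ} (he : M.Quiet n c κ r e)
    {x : M.Coefs n} (hx : M.LocalMin n c r e x) (xs : Fin (M.p n) → L2) (d : M.active n → ℝ)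
    (hd : d ⬝ᵥ (((M.newDesign n xs)ᵀ * (M.gram n)⁻¹ * M.newDesign n xs) *ᵥ d) = 1) :
    |d ⬝ᵥ ((fun j : M.active n => M.newValue n xs (M.extend n x) j
          - M.newValue n xs (M.trueCoef n) j)
        + (n : ℝ) • (((M.newDesign n xs)ᵀ * (M.gram n)⁻¹) *ᵥ M.v0 n)) -
      ∑ i, (M.designActive n *ᵥ ((M.gram n)⁻¹ *ᵥ (M.newDesign n xs *ᵥ d))) i * e i| ≤
    √n * (b + (B + deriv (M.ρ (M.lam n)) (M.a n / 2) / (M.a n / 2)) * (c⁻¹ * (r / √c))) := by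
  have hc := h.mild.pos
  have hn := h.n_pos
  have hn' : (0 : ℝ) < n := by exact_mod_cast hn
  have hsn := Real.sqrt_pos.2 hn'
  have hsc := Real.sqrt_pos.2 hc
  set w : M.active n × Fin (M.q n) → ℝ := M.newDesign n xs *ᵥ d with hw
  -- By the normal equations, testing against `g` reads off the coefficient functional `w`.
  set g : M.Coefs n := WithLp.toLp 2 ((n : ℝ) • ((M.gram n)⁻¹ *ᵥ w)) with hg
  have hval : ∀ y : M.Coefs n, ∀ η : Fin (M.p n) → Fin (M.q n) → ℝ, M.signalPart n η = y →
      d ⬝ᵥ (fun j : M.active n => M.newValue n xs η j) = w ⬝ᵥ y.ofLp := by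
    rintro y η rfl
    simp only [hw, dotProduct, Matrix.mulVec, newDesign, Matrix.of_apply, Fintype.sum_prod_type,
      newValue, signalPart, ite_mul, zero_mul, Finset.sum_ite_eq, Finset.mem_univ, if_true,
      Finset.mul_sum]
    exact Finset.sum_congr rfl fun k _ => Finset.sum_congr rfl fun l _ => by ring
  have hwg : w ⬝ᵥ ((M.gram n)⁻¹ *ᵥ w) = 1 := by
    rw [← hd, hw, ← Matrix.mulVec_mulVec, ← Matrix.mulVec_mulVec, Matrix.dotProduct_mulVec d,
      Matrix.vecMul_transpose]
  -- The normalization of `d` enters here, and yields the factor `√n` of the remainder.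
  have hnormT : ‖∑ k, M.blockMap n k g‖ = √n := by
    have h1 : ‖∑ k, M.blockMap n k g‖ ^ 2 = n := by
      rw [← real_inner_self_eq_norm_sq, hg, inner_normal_equation hn h.gram_unit]
      simp only [dotProduct_smul, hwg, smul_eq_mul, mul_one]
    rw [← h1, Real.sqrt_sq (norm_nonneg _)]
  have hnormg : ‖g‖ ≤ √n / √c := by
    refine abs_le_of_sq_le_sq' ?_ (by positivity) |>.2
    have := h.conditioned.lower g
    rw [hnormT] at this
    rw [div_pow, Real.sq_sqrt hc.le, le_div_iff₀ hc, mul_comm]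
    exact this
  have hv0 : d ⬝ᵥ ((n : ℝ) • (((M.newDesign n xs)ᵀ * (M.gram n)⁻¹) *ᵥ M.v0 n)) =
      ∑ k, inner ℝ (penaltyGradient (M.ρ (M.lam n)) (M.blockMap n k (M.trueSignal n)))
        (M.blockMap n k g) := by
    have h1 : d ⬝ᵥ ((n : ℝ) • (((M.newDesign n xs)ᵀ * (M.gram n)⁻¹) *ᵥ M.v0 n)) =
        M.v0 n ⬝ᵥ g.ofLp := by
      rw [hg, dotProduct_smul, dotProduct_smul, ← Matrix.mulVec_mulVec, Matrix.dotProduct_mulVec d,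
        Matrix.vecMul_transpose, ← hw, Matrix.dotProduct_mulVec w, ← Matrix.mulVec_transpose,
        gram_inv_transpose, dotProduct_comm]
    rw [h1]
    simp only [dotProduct, Fintype.sum_prod_type]
    refine Finset.sum_congr rfl fun k _ => ?_
    set y := M.design n k *ᵥ M.trueCoef n k with hy
    have h2 : M.blockMap n k (M.trueSignal n) = (√n)⁻¹ • WithLp.toLp 2 y := by
      rw [blockMap_apply, trueSignal, blockProj_signalPart, componentMap_apply]
    have h3 : ‖M.blockMap n k (M.trueSignal n)‖ = 1 / √n * enorm2 y := by
      rw [blockMap_apply, trueSignal, blockProj_signalPart, norm_componentMap]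
    have hpos : 0 < enorm2 y := by
      have h4 := M.two_mul_le_norm_blockMap n k
      rw [h3] at h4
      have h5 : 0 < 1 / √n * enorm2 y := by linarith [h.mild.threshold_pos]
      exact (mul_pos_iff_of_pos_left (by positivity)).1 h5
    have h4 : inner ℝ (WithLp.toLp 2 y) (M.blockMap n k g) =
        (√n)⁻¹ * ∑ l, ((M.design n k)ᵀ *ᵥ y) l * g.ofLp (k, l) := by
      rw [blockMap_apply, componentMap_apply, real_inner_smul_right, inner_toLp,
        Matrix.dotProduct_mulVec, ← Matrix.mulVec_transpose]
      rfl
    rw [penaltyGradient, h3, h2, real_inner_smul_left, real_inner_smul_left, h4]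
    simp only [v0, ← hy, Finset.mul_sum]
    refine Finset.sum_congr rfl fun l _ => ?_
    field_simp
  have hdiff : d ⬝ᵥ (fun j : M.active n => M.newValue n xs (M.extend n x) j
          - M.newValue n xs (M.trueCoef n) j) =
      inner ℝ (∑ k, M.blockMap n k x - ∑ k, M.blockMap n k (M.trueSignal n))
        (∑ k, M.blockMap n k g) := by
    have h1 : (fun j : M.active n => M.newValue n xs (M.extend n x) j
          - M.newValue n xs (M.trueCoef n) j) =
        (fun j : M.active n => M.newValue n xs (M.extend n x) j) -
          fun j : M.active n => M.newValue n xs (M.trueCoef n) j := rfl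
    rw [h1, dotProduct_sub, hval x _ (M.signalPart_extend n x), hval (M.trueSignal n) _ rfl,
      inner_sub_left, real_inner_comm, real_inner_comm (∑ k, M.blockMap n k g), hg,
      inner_normal_equation hn h.gram_unit, inner_normal_equation hn h.gram_unit]
  have hlin : ∑ i, (M.designActive n *ᵥ ((M.gram n)⁻¹ *ᵥ w)) i * e i =
      inner ℝ (scaled n e) (∑ k, M.blockMap n k g) := by
    rw [sum_blockMap, hg, Matrix.mulVec_smul, scaled, real_inner_smul_left, real_inner_smul_right,
      inner_toLp, dotProduct_smul, smul_eq_mul, ← mul_assoc, ← mul_assoc, ← mul_inv,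
      Real.mul_self_sqrt hn'.le, inv_mul_cancel₀ hn'.ne', one_mul, dotProduct_comm]
    rfl
  have hst := h.stationary he hx g
  have hpen := abs_sum_inner_penaltyGradient_sub_le h.mild h.conditioned h.curvature
    (h.le_norm_blockMap hx.mem) (M.two_mul_le_norm_blockMap n) g
  simp only [inner_sub_left, Finset.sum_sub_distrib] at hpen
  have hdist : ‖x - M.trueSignal n‖ ≤ r := by simpa [dist_eq_norm] using hx.mem
  have hB : 0 ≤ B + deriv (M.ρ (M.lam n)) (M.a n / 2) / (M.a n / 2) := by
    have h1 := (abs_nonneg _).trans (h.curvature _ le_rfl)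
    have h2 := h.mild.deriv_nonneg h.mild.threshold_pos
    have h3 := h.mild.threshold_pos
    positivity
  have hpen2 := hpen.trans (mul_le_mul_of_nonneg_left (mul_le_mul_of_nonneg_left
    (mul_le_mul hdist hnormg (norm_nonneg _) h.radius_pos.le) (inv_nonneg.2 hc.le)) hB)
  have hbias : |inner ℝ (scaled n (M.bias n)) (∑ k, M.blockMap n k g)| ≤ b * √n := by
    refine (abs_real_inner_le_norm _ _).trans ?_
    rw [hnormT]
    exact mul_le_mul_of_nonneg_right h.bias_le hsn.le
  -- Stationarity at `g` leaves the bias term minus the change of the penalty gradients between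
  -- truth and estimate.
  rw [dotProduct_add, hdiff, hv0, hlin]
  rw [inner_sub_left, inner_add_left, inner_add_left] at hst
  rw [inner_sub_left]
  rw [abs_le] at hpen2 hbias ⊢
  have e1 : √n * (b + (B + deriv (M.ρ (M.lam n)) (M.a n / 2) / (M.a n / 2)) *
      (c⁻¹ * (r / √c))) = b * √n + (B + deriv (M.ρ (M.lam n)) (M.a n / 2) / (M.a n / 2)) *
      (c⁻¹ * (r * (√n / √c))) := by ring
  rw [e1]
  constructor <;> linarith [hpen2.1, hpen2.2, hbias.1, hbias.2]

end Setting

/-! ### Probability of the quiet event. -/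

namespace Setting

open scoped NNReal

variable {M : Setting} {n : ℕ} {c κ r b B : ℝ}

variable {Ω : Type*} [MeasurableSpace Ω] {P : Measure Ω} {ε : Fin n → Ω → ℝ} {v : ℝ≥0}

/-- Markov's inequality for `‖Θᵀε‖²`: each of the `s q` columns has squared norm at most `n / c`,
and the threshold is `(n c r / 8)²`. -/
lemma measure_not_signal_le (hε : IsNoise ε v P) (hn : 0 < n) (hc : 0 < c)
    (hA : WellConditioned (M.blockMap n) c) (hr : 0 < r) :
    P {ω | ¬ ∀ z, inner ℝ (scaled n fun i => ε i ω) (∑ k, M.blockMap n k z) ≤ c / 8 * r * ‖z‖} ≤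
      ENNReal.ofReal (64 * v / c ^ 3 * (M.s n * M.q n / (n * r ^ 2))) := by
  have := hε.indep.isProbabilityMeasure
  have hn' : (0 : ℝ) < n := by exact_mod_cast hn
  set f : Ω → ℝ := fun ω => ∑ kl, (∑ i, M.designActive n i kl * ε i ω) ^ 2 with hf
  have hcol : ∀ kl, ∑ i, M.designActive n i kl ^ 2 ≤ n / c := by
    intro kl
    have h1 := hA.upper (EuclideanSpace.single kl (1 : ℝ))
    rw [sum_blockMap, norm_smul, mul_pow, norm_inv, Real.norm_of_nonneg (Real.sqrt_nonneg _),
      inv_pow, Real.sq_sqrt hn'.le, EuclideanSpace.real_norm_sq_eq, inv_mul_le_iff₀ hn'] at h1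
    simpa [div_eq_mul_inv] using h1
  have hint : Integrable f P := integrable_finsetSum _ fun kl _ => hε.integrable_sum_sq _
  have hexp : ∫ ω, f ω ∂P ≤ v * (M.s n * M.q n) * (n / c) := by
    rw [hf, integral_finsetSum _ fun kl _ => hε.integrable_sum_sq _]
    calc _ ≤ ∑ _kl : M.active n × Fin (M.q n), v * (n / c) := by
          refine Finset.sum_le_sum fun kl _ => ?_
          rw [hε.integral_sum_sq]
          exact mul_le_mul_of_nonneg_left (hcol kl) v.2
      _ = _ := by
          rw [Finset.sum_const, Finset.card_univ, Fintype.card_prod, Fintype.card_coe,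
            Fintype.card_fin, nsmul_eq_mul, s]
          push_cast
          ring
  set t : ℝ := (n * (c / 8 * r)) ^ 2 with ht
  have htpos : 0 < t := by positivity
  have hmarkov := mul_meas_ge_le_integral_of_nonneg (μ := P)
    (ae_of_all _ fun ω => (Finset.sum_nonneg fun kl _ => sq_nonneg _ : 0 ≤ f ω)) hint t
  refine (measure_mono (t := {ω | t ≤ f ω}) ?_).trans ?_
  · intro ω hω
    by_contra hlt
    refine hω fun z => ?_
    replace hlt : f ω < t := not_le.1 hlt
    rw [inner_sum_blockMap]
    have h1 : ((√n)⁻¹ • ((M.designActive n)ᵀ *ᵥ (scaled n fun i => ε i ω).ofLp)) =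
        (n : ℝ)⁻¹ • ((M.designActive n)ᵀ *ᵥ fun i => ε i ω) := by
      rw [scaled, WithLp.ofLp_smul, Matrix.mulVec_smul, smul_smul, ← mul_inv,
        Real.mul_self_sqrt hn'.le]
    rw [h1, ← inner_toLp]
    refine (real_inner_le_norm _ _).trans (mul_le_mul_of_nonneg_right ?_ (norm_nonneg _))
    rw [WithLp.toLp_smul, norm_smul, norm_inv, Real.norm_of_nonneg hn'.le, inv_mul_le_iff₀ hn']
    refine abs_le_of_sq_le_sq' ?_ (by positivity) |>.2
    rw [EuclideanSpace.real_norm_sq_eq]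
    exact hlt.le
  · rw [← ofReal_measureReal]
    refine ENNReal.ofReal_le_ofReal ?_
    have h2 := hmarkov.trans hexp
    rw [← le_div_iff₀' htpos] at h2
    refine h2.trans (le_of_eq ?_)
    rw [ht]
    field_simp
    ring

/-- A union bound over the predictors, each contributing a subspace of dimension at most `q`. -/
lemma measure_not_noise_le (hε : IsNoise ε v P) (hv : v ≠ 0) (hκ : 0 ≤ κ * M.lam n) :
    P {ω | ¬ ∀ j ∉ M.active n, ∀ w ∈ M.noiseSpace n j,
        inner ℝ (WithLp.toLp 2 fun i => ε i ω) w ≤ √n * (κ * M.lam n / 8) * ‖w‖} ≤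
      ENNReal.ofReal (M.p n * (Real.exp (-(3 / (8 * v)) * (n * (κ * M.lam n / 8) ^ 2)) *
        2 ^ M.q n)) := by
  have hx : 0 ≤ √n * (κ * M.lam n / 8) := by positivity
  have hsub : {ω | ¬ ∀ j ∉ M.active n, ∀ w ∈ M.noiseSpace n j,
        inner ℝ (WithLp.toLp 2 fun i => ε i ω) w ≤ √n * (κ * M.lam n / 8) * ‖w‖} ⊆
      ⋃ j, {ω | ∃ w ∈ M.noiseSpace n j,
        √n * (κ * M.lam n / 8) * ‖w‖ < inner ℝ (WithLp.toLp 2 fun i => ε i ω) w} := by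
    intro ω hω
    have hω' : ¬ ∀ j ∉ M.active n, ∀ w ∈ M.noiseSpace n j,
        inner ℝ (WithLp.toLp 2 fun i => ε i ω) w ≤ √n * (κ * M.lam n / 8) * ‖w‖ := hω
    push Not at hω'
    obtain ⟨j, -, w, hw, hlt⟩ := hω'
    exact Set.mem_iUnion.2 ⟨j, w, hw, hlt⟩
  refine (measure_mono hsub).trans ((measure_iUnion_fintype_le _ _).trans ?_)
  have hterm : ∀ j ∈ Finset.univ, P {ω | ∃ w ∈ M.noiseSpace n j,
        √n * (κ * M.lam n / 8) * ‖w‖ < inner ℝ (WithLp.toLp 2 fun i => ε i ω) w} ≤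
      ENNReal.ofReal (Real.exp (-(3 / (8 * v)) * (n * (κ * M.lam n / 8) ^ 2)) * 2 ^ M.q n) := by
    intro j _
    have := hε.measure_exists_mem_lt_inner hv (M.noiseSpace n j) hx (finrank_noiseSpace_le j)
    rwa [mul_pow, Real.sq_sqrt (Nat.cast_nonneg n)] at this
  refine (Finset.sum_le_sum hterm).trans (le_of_eq ?_)
  rw [Finset.sum_const, Finset.card_univ, Fintype.card_fin, nsmul_eq_mul,
    ENNReal.ofReal_mul (Nat.cast_nonneg _), ENNReal.ofReal_natCast]

lemma measure_not_quiet_le (hε : IsNoise ε v P) (hv : v ≠ 0) (h : M.Tuned n c κ r b B) :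
    P {ω | ¬ M.Quiet n c κ r fun i => ε i ω} ≤
      ENNReal.ofReal (64 * v / c ^ 3 * (M.s n * M.q n / (n * r ^ 2))) +
      ENNReal.ofReal (M.p n * (Real.exp (-(3 / (8 * v)) * (n * (κ * M.lam n / 8) ^ 2)) *
        2 ^ M.q n)) := by
  refine (measure_mono ?_).trans ((measure_union_le _ _).trans (add_le_add
    (measure_not_signal_le (M := M) hε h.n_pos h.mild.pos h.conditioned h.radius_pos)
    (measure_not_noise_le (M := M) (κ := κ) hε hv h.lam_pos.le)))
  intro ω hω
  by_contra hcon
  rw [Set.mem_union, not_or] at hcon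
  exact hω ⟨not_not.1 hcon.1, not_not.1 hcon.2⟩

variable (M n c κ r b B) in
/-- The local minimizers can be chosen as a continuous function of the errors. -/
lemma exists_continuous_localMin : ∃ φ : (Fin n → ℝ) → M.Coefs n, Continuous φ ∧
    (M.Tuned n c κ r b B → ∀ e, M.LocalMin n c r e (φ e)) := by
  by_cases h : M.Tuned n c κ r b B
  · obtain ⟨φ, hφ, hmin⟩ := exists_continuous_minimizer h.mild h.conditioned
      (M.two_mul_le_norm_blockMap n) h.radius_pos.le h.radius_le
    refine ⟨fun e => φ (scaled n (M.response n e)), ?_, fun _ e =>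
      ⟨(hmin _).1, (hmin _).2⟩⟩
    unfold scaled response
    fun_prop
  · exact ⟨fun _ => 0, continuous_const, fun h' => absurd h' h⟩

end Setting

/-! ### Asymptotics of the rate conditions. -/

namespace Setting

variable {M : Setting} {α c₀ κ K C Ct : ℝ}

lemma Regular.eventually_pos_a (h : M.Regular α c₀ κ) : ∀ᶠ n in atTop, 0 < M.a n := by
  filter_upwards [h.signal.eventually_gt_atTop 0] with n hn
  have h0 : 0 ≤ (n : ℝ) ^ α := by positivity
  by_contra! hle
  exact absurd hn (not_lt.2 (mul_nonpos_of_nonneg_of_nonpos h0 hle))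

/-- With no signals the infimum defining `a` is `0` by convention, against the signal strength
condition. -/
lemma Regular.eventually_pos_s (h : M.Regular α c₀ κ) : ∀ᶠ n in atTop, 0 < M.s n := by
  filter_upwards [h.eventually_pos_a] with n hn
  by_contra! h0
  have hempty : IsEmpty (M.active n) := by
    rw [Finset.isEmpty_coe_sort]
    exact Finset.card_eq_zero.1 (Nat.le_zero.1 h0)
  rw [a, Real.iInf_of_isEmpty] at hn
  exact lt_irrefl _ hn

lemma Regular.eventually_pos_q (h : M.Regular α c₀ κ) : ∀ᶠ n in atTop, 0 < M.q n := by
  filter_upwards [h.eventually_pos_a] with n hn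
  by_contra! h0
  have hempty : IsEmpty (Fin (M.q n)) := by
    rw [Nat.le_zero.1 h0]
    infer_instance
  have hz : M.a n = 0 := by
    have : ∀ j : M.active n, 1 / √n * enorm2 (M.design n j *ᵥ M.trueCoef n j) = 0 := by
      intro j
      have : M.design n j *ᵥ M.trueCoef n j = 0 := by
        funext i
        simp [Matrix.mulVec, dotProduct]
      simp [this, enorm2]
    rw [a]
    simp only [this]
    exact Real.iInf_const_zero
  exact hn.ne' hz

/-- The order of the truncation bias is negligible relative to `n^{-1/2}`. -/
lemma NormalityRates.eventually_approx_le (h : M.NormalityRates α) {δ : ℝ} (hδ : 0 < δ) :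
    ∀ᶠ n : ℕ in atTop, M.s n * ((M.q n : ℝ) ^ 2)⁻¹ ≤ δ * (n : ℝ) ^ (-(1 / 2 : ℝ)) := by
  filter_upwards [h.approx_rate.def hδ] with n hn
  rwa [Real.norm_of_nonneg (by positivity), Real.norm_of_nonneg (by positivity)] at hn

lemma NormalityRates.tendsto_sqrt_mul_approx (h : M.NormalityRates α) :
    Tendsto (fun n : ℕ => √n * (M.s n * ((M.q n : ℝ) ^ 2)⁻¹)) atTop (𝓝 0) := by
  rw [Metric.tendsto_nhds]
  intro δ hδ
  filter_upwards [h.eventually_approx_le (half_pos hδ), eventually_gt_atTop 0] with n hn hn0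
  have hn' : (0 : ℝ) < n := by exact_mod_cast hn0
  rw [Real.dist_eq, sub_zero, abs_of_nonneg (by positivity)]
  calc _ ≤ √n * (δ / 2 * (n : ℝ) ^ (-(1 / 2 : ℝ))) := by gcongr
    _ = δ / 2 := by
      rw [Real.sqrt_eq_rpow, mul_left_comm, ← Real.rpow_add hn']
      norm_num
    _ < δ := half_lt_self hδ

/-- As `s ≥ 1`, the bias rate `s / q² ≤ n^{-1/2}` forces `q ≥ n^{1/4}`. -/
lemma tendsto_q (hR : M.Regular α c₀ κ) (hN : M.NormalityRates α) :
    Tendsto (fun n => (M.q n : ℝ)) atTop atTop := by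
  have h1 : Tendsto (fun n : ℕ => (n : ℝ) ^ (1 / 4 : ℝ)) atTop atTop :=
    (tendsto_rpow_atTop (by norm_num)).comp tendsto_natCast_atTop_atTop
  refine tendsto_atTop_mono' _ ?_ h1
  filter_upwards [hN.eventually_approx_le one_pos, hR.eventually_pos_s, hR.eventually_pos_q,
    eventually_gt_atTop 0] with n hn hs hq hn0
  have hn' : (0 : ℝ) < n := by exact_mod_cast hn0
  have hq' : (0 : ℝ) < M.q n := by exact_mod_cast hq
  have hs' : (1 : ℝ) ≤ M.s n := by exact_mod_cast hs
  rw [one_mul, Real.rpow_neg hn'.le] at hn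
  have h2 : ((M.q n : ℝ) ^ 2)⁻¹ ≤ ((n : ℝ) ^ (1 / 2 : ℝ))⁻¹ :=
    (le_mul_of_one_le_left (by positivity) hs').trans hn
  rw [inv_le_inv₀ (by positivity) (by positivity)] at h2
  refine abs_le_of_sq_le_sq' ?_ hq'.le |>.2
  rw [← Real.rpow_natCast, ← Real.rpow_mul hn'.le]
  norm_num at h2 ⊢
  exact h2

lemma tendsto_rpow_mul_approx (hα : α < 1 / 2) (h : M.NormalityRates α) :
    Tendsto (fun n : ℕ => (n : ℝ) ^ α * (M.s n * ((M.q n : ℝ) ^ 2)⁻¹)) atTop (𝓝 0) := by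
  refine squeeze_zero' (Eventually.of_forall fun n => by positivity) ?_ h.tendsto_sqrt_mul_approx
  filter_upwards [eventually_ge_atTop 1] with n hn
  have hn' : (1 : ℝ) ≤ n := by exact_mod_cast hn
  rw [Real.sqrt_eq_rpow]
  gcongr

/-- The number of signal coefficients is negligible relative to `n^{1 - 2α}`. -/
lemma tendsto_dim (hK : 0 < K) (hR : M.Regular α c₀ κ) (hS : M.SelectionRates α K) :
    Tendsto (fun n : ℕ => M.s n * M.q n / (n * ((n : ℝ) ^ (-α)) ^ 2)) atTop (𝓝 0) := by
  have h1 : Tendsto (fun n : ℕ => K * (M.lam n * (n : ℝ) ^ α * M.q n * √(M.s n)) ^ 2) atTop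
      (𝓝 0) := by
    simpa using (hS.lam_upper.pow 2).const_mul K
  refine squeeze_zero' (Eventually.of_forall fun n => by positivity) ?_ h1
  filter_upwards [hS.lam_lower, hR.eventually_pos_q, eventually_gt_atTop 0] with n hl hq hn
  have hn' : (0 : ℝ) < n := by exact_mod_cast hn
  have hq' : (1 : ℝ) ≤ M.q n := by exact_mod_cast hq
  have hlog : 0 ≤ Real.log (M.p n) := Real.log_natCast_nonneg _
  have hql : (M.q n : ℝ) ≤ K * (n * M.lam n ^ 2) := by linarith
  have hpow : ((n : ℝ) ^ (-α)) ^ 2 = (((n : ℝ) ^ α) ^ 2)⁻¹ := by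
    rw [Real.rpow_neg hn'.le, inv_pow]
  rw [hpow, div_le_iff₀ (by positivity)]
  have h2 : K * (M.lam n * (n : ℝ) ^ α * M.q n * √(M.s n)) ^ 2 * (n * (((n : ℝ) ^ α) ^ 2)⁻¹) =
      (M.s n * (M.q n) ^ 2) * (K * (n * M.lam n ^ 2)) := by
    simp only [mul_pow, Real.sq_sqrt (Nat.cast_nonneg (M.s n))]
    have : ((n : ℝ) ^ α) ^ 2 ≠ 0 := by positivity
    field_simp
  rw [h2]
  -- The lower bound on `λ` enters through `1 ≤ q ≤ K n λ²`.
  calc (M.s n : ℝ) * M.q n ≤ M.s n * M.q n ^ 2 := by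
        gcongr
        exact le_self_pow₀ hq' two_ne_zero
    _ = M.s n * M.q n ^ 2 * 1 := (mul_one _).symm
    _ ≤ _ := by
        gcongr
        exact hq'.trans hql

/-- The penalty slope at the signals is negligible. -/
lemma Regular.tendsto_slope (hR : M.Regular α c₀ κ) :
    Tendsto (fun n : ℕ => (n : ℝ) ^ α * (deriv (M.ρ (M.lam n)) (M.a n / 2) * √(M.s n))) atTop
      (𝓝 0) := by
  rw [Metric.tendsto_nhds]
  intro δ hδ
  filter_upwards [hR.deriv_small.def (half_pos hδ), hR.eventually_pos_s, hR.eventually_pos_q,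
    eventually_gt_atTop 0] with n hd hs hq hn
  have hn' : (0 : ℝ) < n := by exact_mod_cast hn
  have hs' : (0 : ℝ) < M.s n := by exact_mod_cast hs
  have hq' : (1 : ℝ) ≤ M.q n := by exact_mod_cast hq
  rw [Real.norm_eq_abs, Real.norm_of_nonneg (by positivity)] at hd
  rw [Real.dist_eq, sub_zero, abs_mul, abs_mul, abs_of_nonneg (by positivity : 0 ≤ (n : ℝ) ^ α),
    abs_of_nonneg (Real.sqrt_nonneg _)]
  have h1 : (n : ℝ) ^ α * (n : ℝ) ^ (-α) = 1 := by
    rw [← Real.rpow_add hn']; simp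
  have h2 : (M.s n : ℝ) ^ (-(1 / 2 : ℝ)) * √(M.s n) = 1 := by
    rw [Real.sqrt_eq_rpow, ← Real.rpow_add hs']; simp
  calc _ ≤ (n : ℝ) ^ α * (δ / 2 * ((n : ℝ) ^ (-α) * (M.q n : ℝ)⁻¹ *
        (M.s n : ℝ) ^ (-(1 / 2 : ℝ))) * √(M.s n)) := by gcongr
    _ = δ / 2 * (M.q n : ℝ)⁻¹ * ((n : ℝ) ^ α * (n : ℝ) ^ (-α)) *
        ((M.s n : ℝ) ^ (-(1 / 2 : ℝ)) * √(M.s n)) := by ring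
    _ ≤ δ / 2 := by
        rw [h1, h2, mul_one, mul_one]
        exact mul_le_of_le_one_right (half_pos hδ).le (inv_le_one_of_one_le₀ hq')
    _ < δ := half_lt_self hδ

/-- This is the part of the gradient remainder caused by the change of direction over a distance
`n^{-α}`. -/
lemma NormalityRates.tendsto_slope (hR : M.Regular α c₀ κ) (hN : M.NormalityRates α) :
    Tendsto (fun n : ℕ => √n * (deriv (M.ρ (M.lam n)) (M.a n / 2) / (M.a n / 2) *
      (n : ℝ) ^ (-α))) atTop (𝓝 0) := by
  rw [Metric.tendsto_nhds]
  intro δ hδ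
  filter_upwards [hN.deriv_rate.def (by positivity : 0 < δ / 4), hR.eventually_pos_s,
    hR.eventually_pos_a, eventually_gt_atTop 0] with n hd hs ha hn
  have hn' : (0 : ℝ) < n := by exact_mod_cast hn
  have hs' : (1 : ℝ) ≤ M.s n := by exact_mod_cast hs
  rw [Real.norm_eq_abs, Real.norm_of_nonneg (by positivity)] at hd
  rw [Real.dist_eq, sub_zero, abs_mul, abs_mul, abs_div,
    abs_of_nonneg (by positivity : 0 ≤ (n : ℝ) ^ (-α)),
    abs_of_nonneg (Real.sqrt_nonneg _), abs_of_nonneg (by positivity : 0 ≤ M.a n / 2)]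
  have h1 : √n * (n : ℝ) ^ (α - 1 / 2) * (n : ℝ) ^ (-α) = 1 := by
    rw [Real.sqrt_eq_rpow, ← Real.rpow_add hn', ← Real.rpow_add hn']
    norm_num
  have h2 : (M.s n : ℝ) ^ (-(1 / 2 : ℝ)) ≤ 1 :=
    Real.rpow_le_one_of_one_le_of_nonpos hs' (by norm_num)
  calc _ ≤ √n * (δ / 4 * (M.a n * (n : ℝ) ^ (α - 1 / 2) * (M.s n : ℝ) ^ (-(1 / 2 : ℝ))) /
        (M.a n / 2) * (n : ℝ) ^ (-α)) := by gcongr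
    _ = δ / 2 * (√n * (n : ℝ) ^ (α - 1 / 2) * (n : ℝ) ^ (-α)) *
        (M.s n : ℝ) ^ (-(1 / 2 : ℝ)) := by
        field_simp
        ring
    _ ≤ δ / 2 := by
        rw [h1, mul_one]
        exact mul_le_of_le_one_right (half_pos hδ).le h2
    _ < δ := half_lt_self hδ

lemma tendsto_rpow_neg (hα : 0 < α) : Tendsto (fun n : ℕ => (n : ℝ) ^ (-α)) atTop (𝓝 0) :=
  (tendsto_rpow_neg_atTop hα).comp tendsto_natCast_atTop_atTop

/-- A bound for the truncation bias. -/
def biasBound (M : Setting) (C Ct : ℝ) (n : ℕ) : ℝ :=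
  √(C ^ 2) * √Ct * (M.s n * ((M.q n : ℝ) ^ 2)⁻¹)

lemma eventually_tuned (hα : α < 1 / 2) (hc : 0 < c₀) (hκ : 0 < κ) (hM : M.Smooth C Ct)
    (hR : M.Regular α c₀ κ) (hS : M.SelectionRates α K) (hN : M.NormalityRates α) {B : ℝ}
    (hB : ∀ᶠ n : ℕ in atTop, ∀ t ≥ M.a n / 2,
      |deriv (deriv (M.ρ (M.lam n))) t| ≤ B * (n : ℝ) ^ (-(1 / 2 : ℝ))) :
    ∀ᶠ n : ℕ in atTop, M.Tuned n c₀ κ ((n : ℝ) ^ (-α)) (M.biasBound C Ct n)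
      (B * (n : ℝ) ^ (-(1 / 2 : ℝ))) := by
  have hsc := Real.sqrt_pos.2 hc
  set D := √(C ^ 2) * √Ct with hD
  have hD0 : 0 ≤ D := by positivity
  -- The bound `3 * c₀ / 8` is what remains of `c₀ / 2` after the error share `c₀ / 8`.
  have hgrad : ∀ᶠ n : ℕ in atTop, D * ((n : ℝ) ^ α * (M.s n * ((M.q n : ℝ) ^ 2)⁻¹)) / √c₀ +
      (n : ℝ) ^ α * (deriv (M.ρ (M.lam n)) (M.a n / 2) * √(M.s n)) / √c₀ < 3 * c₀ / 8 := by
    have : Tendsto (fun n : ℕ => D * ((n : ℝ) ^ α * (M.s n * ((M.q n : ℝ) ^ 2)⁻¹)) / √c₀ +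
      (n : ℝ) ^ α * (deriv (M.ρ (M.lam n)) (M.a n / 2) * √(M.s n)) / √c₀) atTop
      (𝓝 (D * 0 / √c₀ + 0 / √c₀)) :=
      (((tendsto_rpow_mul_approx hα hN).const_mul D).div_const _).add
        (hR.tendsto_slope.div_const _)
    refine this.eventually (gt_mem_nhds ?_)
    simp only [mul_zero, zero_div, add_zero]
    positivity
  -- `D + 1` is used in place of `D`, which may vanish.
  have happrox := hS.approx.def (by positivity : 0 < κ / (8 * (D + 1)))
  filter_upwards [hgrad, happrox, hB, hR.eventually_pos_a, hR.eventually_pos_q,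
    eventually_gt_atTop 0, hR.differentiable_deriv,
    hR.second_deriv_small (c₀ ^ 2 / 2) (by positivity), hR.eigenvalues, hR.noise_invertible,
    hR.signal.eventually_ge_atTop (2 / √c₀), hR.slope_ge, hR.irrepresentable]
    with n hg hap hBn ha hq hn hdd hsd hev hni hsig hsl hirr
  have hn' : (0 : ℝ) < n := by exact_mod_cast hn
  have hlam := hS.lam_pos n
  have hb0 : 0 ≤ M.biasBound C Ct n := by unfold biasBound; positivity
  have hαα : (n : ℝ) ^ (-α) * (n : ℝ) ^ α = 1 := by
    rw [← Real.rpow_add hn']; simp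
  have hr0 : 0 < (n : ℝ) ^ (-α) := by positivity
  refine ⟨hn, ⟨hc, by positivity, hR.monotone _ hlam, hR.differentiable _ hlam,
    hR.antitone_deriv _ hlam, hdd, hsd⟩, hR.concave _ hlam, M.wellConditioned n hn hev,
    M.isUnit_det_gram n hc hev, hni, hr0, ?_,
    norm_scaled_le hn hb0 fun i => hM.abs_bias_le hq i, ?_, by positivity, ?_, hsl, hirr, hBn⟩
  · rw [div_le_iff₀ hsc] at hsig
    have := mul_le_mul_of_nonneg_left hsig hr0.le
    have e : (n : ℝ) ^ (-α) * ((n : ℝ) ^ α * M.a n * √c₀) = √c₀ * M.a n := by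
      calc _ = ((n : ℝ) ^ (-α) * (n : ℝ) ^ α) * (√c₀ * M.a n) := by ring
        _ = _ := by rw [hαα, one_mul]
    rw [e] at this
    linarith
  · have := mul_lt_mul_of_pos_left hg hr0
    have e : (n : ℝ) ^ (-α) * (D * ((n : ℝ) ^ α * (M.s n * ((M.q n : ℝ) ^ 2)⁻¹)) / √c₀ +
        (n : ℝ) ^ α * (deriv (M.ρ (M.lam n)) (M.a n / 2) * √(M.s n)) / √c₀) =
        M.biasBound C Ct n / √c₀ +
          deriv (M.ρ (M.lam n)) (M.a n / 2) * (√(M.s n) / √c₀) := by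
      rw [biasBound, ← hD]
      calc _ = ((n : ℝ) ^ (-α) * (n : ℝ) ^ α) * (D * (M.s n * ((M.q n : ℝ) ^ 2)⁻¹) / √c₀ +
            deriv (M.ρ (M.lam n)) (M.a n / 2) * (√(M.s n) / √c₀)) := by ring
        _ = _ := by rw [hαα, one_mul]
    rw [e] at this
    linarith
  · rw [Real.norm_of_nonneg (by positivity), Real.norm_of_nonneg hlam.le] at hap
    rw [biasBound, ← hD]
    calc _ ≤ D * (κ / (8 * (D + 1)) * M.lam n) := by gcongr
      _ = κ * M.lam n / 8 * (D / (D + 1)) := by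
          field_simp
      _ ≤ κ * M.lam n / 8 := mul_le_of_le_one_right (by positivity)
          ((div_le_one (by positivity)).2 (by linarith))

lemma tendsto_remainder (hα₀ : 0 < α) (hR : M.Regular α c₀ κ)
    (hN : M.NormalityRates α) (C Ct B : ℝ) :
    Tendsto (fun n : ℕ => √n * (M.biasBound C Ct n +
      (B * (n : ℝ) ^ (-(1 / 2 : ℝ)) + deriv (M.ρ (M.lam n)) (M.a n / 2) / (M.a n / 2)) *
        (c₀⁻¹ * ((n : ℝ) ^ (-α) / √c₀)))) atTop (𝓝 0) := by
  have h1 := hN.tendsto_sqrt_mul_approx.const_mul (√(C ^ 2) * √Ct)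
  have h2 := (tendsto_rpow_neg hα₀).const_mul (B * (c₀⁻¹ / √c₀))
  have h3 := (hN.tendsto_slope hR).const_mul (c₀⁻¹ / √c₀)
  have h4 := (h1.add h2).add h3
  simp only [mul_zero, add_zero] at h4
  refine h4.congr' ?_
  filter_upwards [eventually_gt_atTop 0] with n hn
  have hn' : (0 : ℝ) < n := by exact_mod_cast hn
  have e : √n * (n : ℝ) ^ (-(1 / 2 : ℝ)) = 1 := by
    rw [Real.sqrt_eq_rpow, ← Real.rpow_add hn']; norm_num
  rw [biasBound]
  calc _ = √(C ^ 2) * √Ct * (√n * (M.s n * ((M.q n : ℝ) ^ 2)⁻¹)) +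
        B * (c₀⁻¹ / √c₀) * (n : ℝ) ^ (-α) * (√n * (n : ℝ) ^ (-(1 / 2 : ℝ))) +
        c₀⁻¹ / √c₀ * (√n * (deriv (M.ρ (M.lam n)) (M.a n / 2) / (M.a n / 2) *
          (n : ℝ) ^ (-α))) := by rw [e, mul_one]
    _ = _ := by ring

/-- The union bound over the noise predictors. -/
lemma tendsto_union_bound {σ : ℝ} (hσ : 0 < σ) (hκ : 0 < κ) (hR : M.Regular α c₀ κ)
    (hS : M.SelectionRates α (3 * κ ^ 2 / (1024 * σ ^ 2))) (hN : M.NormalityRates α) :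
    Tendsto (fun n : ℕ => M.p n * (Real.exp (-(3 / (8 * σ ^ 2)) *
      (n * (κ * M.lam n / 8) ^ 2)) * 2 ^ M.q n)) atTop (𝓝 0) := by
  have h1 : Tendsto (fun n => Real.exp (-(M.q n : ℝ))) atTop (𝓝 0) :=
    Real.tendsto_exp_neg_atTop_nhds_zero.comp (tendsto_q hR hN)
  refine squeeze_zero' (Eventually.of_forall fun n => by positivity) ?_ h1
  filter_upwards [hS.lam_lower] with n hl
  rcases Nat.eq_zero_or_pos (M.p n) with hp | hp
  -- Without predictors `p` is not `exp (log p)`, so this case is separate.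
  · rw [hp, Nat.cast_zero, zero_mul]
    positivity
  have hp' : (0 : ℝ) < M.p n := by exact_mod_cast hp
  have hlog : 0 ≤ Real.log (M.p n) := Real.log_natCast_nonneg _
  have h2 : (2 : ℝ) ^ M.q n ≤ Real.exp (M.q n) := by
    rw [← Real.exp_one_pow]
    exact pow_le_pow_left₀ (by norm_num) (by linarith [Real.add_one_le_exp 1]) _
  -- The constant is chosen so that the exponent is `2 K n λ² ≥ 2 (q + log p)`: one half beats `p *
  -- 2 ^ q`, the other leaves `exp (-q)`.
  have h3 : 3 / (8 * σ ^ 2) * (n * (κ * M.lam n / 8) ^ 2) =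
      2 * (3 * κ ^ 2 / (1024 * σ ^ 2) * (n * M.lam n ^ 2)) := by
    field_simp
    ring
  calc _ ≤ Real.exp (Real.log (M.p n)) * (Real.exp (-(3 / (8 * σ ^ 2)) *
        (n * (κ * M.lam n / 8) ^ 2)) * Real.exp (M.q n)) := by
        rw [Real.exp_log hp']
        gcongr
    _ ≤ Real.exp (-(M.q n : ℝ)) := by
        rw [← Real.exp_add, ← Real.exp_add, Real.exp_le_exp, neg_mul, h3]
        linarith

end Setting

end FAR

end

/-! ### Assembly of the main theorem. -/

theorem corollary2 (σ κ : ℝ) (hσ : 0 < σ) (hκ : 0 < κ) :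
    ∃ K : ℝ, 0 < K ∧
      ∀ (M : FAR.Setting) (α c₀ C Ct : ℝ), 0 < α → α < 1 / 2 → 0 < c₀ →
        M.Smooth C Ct → M.Regular α c₀ κ → M.SelectionRates α K → M.NormalityRates α →
      ∀ {Ω : Type*} [MeasurableSpace Ω] (P : Measure Ω) [IsProbabilityMeasure P]
        (ε : ∀ n : ℕ, Fin n → Ω → ℝ),
        (∀ n, iIndepFun (ε n) P) →
        (∀ n i, HasLaw (ε n i) (gaussianReal 0 (σ ^ 2).toNNReal) P) →
      ∃ ηhat : ∀ n : ℕ, Ω → Fin (M.p n) → Fin (M.q n) → ℝ,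
        (∀ n, AEMeasurable (ηhat n) P) ∧
        ∀ xs : ∀ n : ℕ, Fin (M.p n) → FAR.L2,
          -- with probability tending to one (in the strong sense that the exceptional set has
          -- outer measure tending to zero)
          Tendsto (fun n => P {ω | ¬ (M.IsFAREstimate n (M.response n fun i => ε n i ω) (ηhat n ω) ∧
            ∀ j ∉ M.active n, M.newValue n (xs n) (ηhat n ω) j = 0)}) atTop (𝓝 0) ∧
          ∀ c : ∀ n : ℕ, M.active n → ℝ,
            (∀ᶠ n in atTop,
              c n ⬝ᵥ (((M.newDesign n (xs n))ᵀ * (M.gram n)⁻¹ * M.newDesign n (xs n)) *ᵥ c n) = 1) →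
            TendstoInDistribution
              (fun n ω => c n ⬝ᵥ
                ((fun j : M.active n => M.newValue n (xs n) (ηhat n ω) j
                    - M.newValue n (xs n) (M.trueCoef n) j)
                  + (n : ℝ) • (((M.newDesign n (xs n))ᵀ * (M.gram n)⁻¹) *ᵥ M.v0 n)))
              atTop id (fun _ => P) (gaussianReal 0 (σ ^ 2).toNNReal) := by
  have hσ2 : (0 : ℝ) < σ ^ 2 := by positivity
  have hv : (σ ^ 2).toNNReal ≠ 0 := by simpa using hσ.ne'
  have hvc : (((σ ^ 2).toNNReal : NNReal) : ℝ) = σ ^ 2 := Real.coe_toNNReal _ hσ2.le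
  refine ⟨3 * κ ^ 2 / (1024 * σ ^ 2), by positivity, ?_⟩
  intro M α c₀ C Ct hα hα2 hc hM hR hS hN Ω _ P _ ε hind hlaw
  have hε : ∀ n, FAR.IsNoise (ε n) (σ ^ 2).toNNReal P := fun n => ⟨hind n, hlaw n⟩
  obtain ⟨B, hB⟩ := hN.second_deriv_rate
  set r : ℕ → ℝ := fun n => (n : ℝ) ^ (-α) with hr
  set b : ℕ → ℝ := M.biasBound C Ct with hb
  set curv : ℕ → ℝ := fun n => B * (n : ℝ) ^ (-(1 / 2 : ℝ)) with hcurv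
  have hT : ∀ᶠ n : ℕ in atTop, M.Tuned n c₀ κ (r n) (b n) (curv n) :=
    FAR.Setting.eventually_tuned hα2 hc hκ hM hR hS hN hB
  choose φ hφ hmin using fun n =>
    FAR.Setting.exists_continuous_localMin M n c₀ κ (r n) (b n) (curv n)
  have hquiet : Tendsto (fun n => P {ω | ¬ M.Quiet n c₀ κ (r n) fun i => ε n i ω}) atTop (𝓝 0) := by
    have h1 := ENNReal.tendsto_ofReal ((FAR.Setting.tendsto_dim (by positivity) hR hS).const_mul
      (64 * ((σ ^ 2).toNNReal : ℝ) / c₀ ^ 3))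
    have h2 := ENNReal.tendsto_ofReal (FAR.Setting.tendsto_union_bound hσ hκ hR hS hN)
    have h3 := h1.add h2
    rw [mul_zero, ENNReal.ofReal_zero, add_zero] at h3
    refine tendsto_of_tendsto_of_tendsto_of_le_of_le' tendsto_const_nhds h3
      (Eventually.of_forall fun _ => zero_le) ?_
    filter_upwards [hT] with n hn
    have := FAR.Setting.measure_not_quiet_le (hε n) hv hn
    rwa [hvc] at this ⊢
  have hεm : ∀ n, AEMeasurable (fun ω i => ε n i ω) P := fun n =>
    aemeasurable_pi_lambda _ fun i => (hlaw n i).aemeasurable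
  have hηc : ∀ n, Continuous fun e => M.extend n (φ n e) := fun n =>
    (M.continuous_extend n).comp (hφ n)
  refine ⟨fun n ω => M.extend n (φ n fun i => ε n i ω),
    fun n => (hηc n).measurable.comp_aemeasurable (hεm n), fun xs => ⟨?_, fun c hcn => ?_⟩⟩
  · refine tendsto_of_tendsto_of_tendsto_of_le_of_le' tendsto_const_nhds hquiet
      (Eventually.of_forall fun _ => zero_le) ?_
    filter_upwards [hT] with n hn
    refine measure_mono fun ω hω hq => hω ⟨hn.isFAREstimate hq (hmin n hn _), fun j hj => ?_⟩
    rw [FAR.Setting.newValue, M.extend_of_notMem n _ hj, dotProduct_zero]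
  · set a : ∀ n, Fin n → ℝ := fun n =>
      M.designActive n *ᵥ ((M.gram n)⁻¹ *ᵥ (M.newDesign n (xs n) *ᵥ c n)) with ha
    have hlin : TendstoInDistribution (fun n ω => ∑ i, a n i * ε n i ω) atTop id (fun _ => P)
        (gaussianReal 0 (σ ^ 2).toNNReal) := by
      refine ⟨fun n => ((hε n).hasLaw_sum (a n)).aemeasurable, aemeasurable_id, ?_⟩
      -- For all large `n` the linear form already has exactly the limit law, so no central limit
      -- theorem is needed.
      refine tendsto_const_nhds.congr' ?_
      filter_upwards [hcn, hT] with n h1 hn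
      refine Subtype.ext ?_
      have h2 : ∑ i, a n i ^ 2 = 1 := by
        have h3 : ∑ i, a n i ^ 2 = a n ⬝ᵥ a n := by
          simp only [dotProduct, pow_two]
        rw [h3, ha]
        simp only
        rw [← M.dotProduct_gram_mulVec, Matrix.mulVec_mulVec _ (M.gram n),
          Matrix.mul_nonsing_inv _ hn.gram_unit, Matrix.one_mulVec, ← h1, dotProduct_comm,
          ← Matrix.mulVec_mulVec, ← Matrix.mulVec_mulVec, Matrix.dotProduct_mulVec (c n),
          Matrix.vecMul_transpose]
      simp only [Measure.map_id]
      rw [((hε n).hasLaw_sum (a n)).map_eq, h2, Real.toNNReal_one, mul_one]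
    -- Slutsky: it remains to show that the difference to the linear form tends to zero in
    -- probability.
    refine tendstoInDistribution_of_tendstoInMeasure_sub _ _ hlin ?_ ?_
    · intro δ hδ
      have hrem := ENNReal.tendsto_ofReal (FAR.Setting.tendsto_remainder (c₀ := c₀) hα hR hN C Ct B)
      rw [ENNReal.ofReal_zero] at hrem
      refine tendsto_of_tendsto_of_tendsto_of_le_of_le' tendsto_const_nhds hquiet
        (Eventually.of_forall fun _ => zero_le) ?_
      filter_upwards [hT, hcn, hrem.eventually (gt_mem_nhds hδ)] with n hn h1 h2
      -- Once the deterministic remainder is below `δ`, a deviation of size `δ` can only occur off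
      -- the quiet event.
      refine measure_mono fun ω hω hq => ?_
      have h3 := hn.abs_expansion_le hq (hmin n hn _) (xs n) (c n) h1
      refine absurd h2 (not_lt.2 (le_trans hω ?_))
      rw [Pi.sub_apply, Pi.sub_apply, edist_dist, Real.dist_eq]
      change ENNReal.ofReal |_ - (0 : ℝ)| ≤ _
      rw [sub_zero]
      exact ENNReal.ofReal_le_ofReal h3
    · intro n
      have hcont : Continuous fun e : Fin n → ℝ => c n ⬝ᵥ
          ((fun j : M.active n => M.newValue n (xs n) (M.extend n (φ n e)) j
            - M.newValue n (xs n) (M.trueCoef n) j)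
          + (n : ℝ) • (((M.newDesign n (xs n))ᵀ * (M.gram n)⁻¹) *ᵥ M.v0 n)) := by
        unfold FAR.Setting.newValue
        have := hηc n
        fun_prop
      exact hcont.measurable.comp_aemeasurable (hεm n)
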